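/- Let $E$ be a Euclidean space of dimension $2n+2$ (for example $\mathbb R^{2n+2}$), $S^{2n+1}$ its unit sphere, and $G_2E$ the Grassmann manifold of oriented 2-planes through the origin of $E$, each identified with the oriented great circle in which it meets $S^{2n+1}$. For $P\in G_2E$, the map sending $L\in\mathrm{Hom}(P,P^\perp)$ to the graph of $L$ (oriented so that the orthogonal projection to $P$ preserves orientations) is a diffeomorphism onto an open neighbourhood $N(P)$ of $P$, and it identifies $T_PG_2E$ with $\mathrm{Hom}(P,P^\perp)$. The bad cone $BC(P)\subset T_PG_2E$ is the tangent cone at $P$ of the set of oriented 2-planes which meet $P$ in at least a line; a linear subspace of $T_PG_2E$ is transverse to it if it meets $BC(P)$ only in $0$. Fix a positively oriented orthonormal basis $(e_1,e_2)$ of $P$; it identifies $\mathrm{Hom}(P,P^\perp)$ with $P^\perp\times P^\perp$ by $L\mapsto(Le_1,Le_2)$. **Proposition 4.** Let $T\subset T_PG_2E$ be a $2n$-dimensional linear subspace transverse to $BC(P)$. Then: 1. $T$ is the graph $\{L : Le_2=A(Le_1)\}$ of a linear map $A:P^\perp\to P^\perp$ with no real eigenvalues, and there is a linear complex structure $J_A:P^\perp\to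 P^\perp$ whose complexification is multiplication by $i$ (resp. $-i$) on the generalized eigenspaces of the complexification of $A$ for the eigenvalues with positive (resp. negative) imaginary part. Extend $J_A$ to $E=P\oplus P^\perp$ by the rotation $e_1\mapsto e_2\mapsto -e_1$ of $P$, and let $M_{J_A}\subset G_2E$ be the set of $J_A$-complex lines, oriented by the bases $(v,J_Av)$ (the base space of the Hopf-like fibration of $J_A$). 2. There is an $\varepsilon>0$ such that the following holds for every smooth bump function $f:[0,\infty)\to[0,1]$ which equals $1$ near $0$, equals $0$ for all large arguments, and varies slowly in the sense that $s\,|f'(s)|<\varepsilon$ for all $s\ge 0$. Put $$N(x)=f(|x|)\,A(x)+(1-f(|x|))\,J_A(x)\qquad(x\in P^\perp),$$ and let $M_F\subset G_2E$ be the set which in $N(P)$ is the graph $\{L: Le_2=N(Le_1)\}$ of $N$, and which outside of $N(P)$ coincides with $M_{J_A}$. Then $M_F$ is the base space (set of fibres) of a smooth fibration $F$ of $S^{2n+1}$ by oriented great circles, it is a closed smooth $2n$-dimensional submanifold of $G_2E$, it contains $P$, and $T_PM_F=T$. 3. Such functions $f$ exist; moreover, for every neighbourhood $U$ of $P$ in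 $G_2E$, $f$ can be chosen so that $M_F$ agrees with $M_{J_A}$ outside of $U$. In particular there is a smooth fibration of $S^{2n+1}$ by oriented great circles whose base space is tangent at $P$ to $T$. -/

import Mathlib

open Set Filter Topology Metric Manifold TensorProduct
open scoped ContDiff

noncomputable section

/-- An oriented 2-plane through the origin of `E`, i.e. a point of the Grassmannian of oriented
2-planes.  The oriented 2-plane and the oriented great circle which it cuts out on the unit sphere
are identified. -/
structure OrientedPlane (E : Type*) [NormedAddCommGroup E] [InnerProductSpace ℝ E] where
  /-- the underlying 2-plane -/
  plane : Submodule ℝ E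
  finrank_plane : Module.finrank ℝ plane = 2
  /-- its orientation -/
  orientation : Orientation ℝ plane (Fin 2)

namespace OrientedPlane

variable {E : Type*} [NormedAddCommGroup E] [InnerProductSpace ℝ E]

theorem finiteDimensional_plane (P : OrientedPlane E) : FiniteDimensional ℝ P.plane :=
  FiniteDimensional.of_finrank_pos (by rw [P.finrank_plane]; norm_num)

instance (P : OrientedPlane E) : FiniteDimensional ℝ P.plane := P.finiteDimensional_plane

/-- `Hom(P, Pᗮ)`: the model of the coordinate neighbourhood of `P`, and also (through the
differential of the chart at `P`) the tangent space of the Grassmannian at `P`. -/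
abbrev Tangent (P : OrientedPlane E) : Type _ := P.plane →L[ℝ] P.planeᗮ

/-- The map `v ↦ v + L v` from `P` to `E = P ⊕ Pᗮ`. -/
def graphMap (P : OrientedPlane E) (L : P.Tangent) : P.plane →ₗ[ℝ] E :=
  P.plane.subtype + P.planeᗮ.subtype ∘ₗ (L : P.plane →ₗ[ℝ] P.planeᗮ)

theorem graphMap_apply (P : OrientedPlane E) (L : P.Tangent) (v : P.plane) :
    P.graphMap L v = (v : E) + (L v : E) := rfl

theorem graphMap_injective (P : OrientedPlane E) (L : P.Tangent) :
    Function.Injective (P.graphMap L) := by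
  rw [injective_iff_map_eq_zero]
  intro v hv
  rw [graphMap_apply] at hv
  have h1 : inner ℝ (v : E) (L v : E) = 0 :=
    Submodule.inner_right_of_mem_orthogonal v.2 (L v).2
  have h2 : inner ℝ (v : E) ((v : E) + (L v : E)) = 0 := by rw [hv, inner_zero_right]
  rw [inner_add_right, h1, add_zero, inner_self_eq_zero] at h2
  exact Subtype.ext h2

/-- The linear isomorphism from `P` onto the graph of `L`. -/
def graphEquiv (P : OrientedPlane E) (L : P.Tangent) :
    P.plane ≃ₗ[ℝ] LinearMap.range (P.graphMap L) :=
  LinearEquiv.ofInjective (P.graphMap L) (P.graphMap_injective L)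

/-- The inverse of the chart at `P`: the graph of `L : P → Pᗮ`, an oriented 2-plane oriented so
that the orthogonal projection to `P` preserves orientations.  Its range is the coordinate
neighbourhood `N(P)`: the oriented 2-planes which project isomorphically to `P` with
preservation of the orientations. -/
def graph (P : OrientedPlane E) (L : P.Tangent) : OrientedPlane E where
  plane := LinearMap.range (P.graphMap L)
  finrank_plane := by rw [← (P.graphEquiv L).finrank_eq, P.finrank_plane]
  orientation := Orientation.map (Fin 2) (P.graphEquiv L) P.orientation

/-- The topology of the Grassmannian of oriented 2-planes as a manifold with the charts inverse to
`graph P`: a set is open iff its preimages under all `graph P` are open. -/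
instance : TopologicalSpace (OrientedPlane E) :=
  ⨆ P : OrientedPlane E, TopologicalSpace.coinduced P.graph inferInstance

/-- The tangent cone at `P` of a subset of the Grassmannian, computed in the chart at `P` (where
`P` itself is the origin).  If the subset is a smooth submanifold through `P`, this is its tangent
space. -/
def tangentCone (M : Set (OrientedPlane E)) (P : OrientedPlane E) : Set P.Tangent :=
  posTangentConeAt (P.graph ⁻¹' M) 0

/-- The bad set `BS(P)`: the oriented 2-planes which meet `P` in at least a line. -/
def badSet (P : OrientedPlane E) : Set (OrientedPlane E) := {Q | P.plane ⊓ Q.plane ≠ ⊥}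

/-- The bad cone `BC(P)`: the tangent cone at `P` to the bad set of `P`. -/
def badCone (P : OrientedPlane E) : Set P.Tangent := tangentCone P.badSet P

/-- A linear subspace of the tangent space at `P` is transverse to the bad cone if it meets the
bad cone only at the origin. -/
def IsTransverseToBadCone (P : OrientedPlane E) (T : Submodule ℝ P.Tangent) : Prop :=
  (T : Set P.Tangent) ∩ P.badCone = {0}

/-- Given a basis `e` of `P`, the isomorphism `L ↦ (L e₀, L e₁)` identifies `Hom(P, Pᗮ)` with
`Pᗮ × Pᗮ`.  This is the graph in it of the linear map `A` from the first to the second factor. -/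
def graphSubspace (P : OrientedPlane E) (e : OrthonormalBasis (Fin 2) ℝ P.plane)
    (A : Module.End ℝ P.planeᗮ) : Submodule ℝ P.Tangent where
  carrier := {L | L (e 1) = A (L (e 0))}
  add_mem' := by
    intro L L' h h'
    simp only [mem_ofPred_eq] at h h'
    simp [h, h']
  zero_mem' := by simp
  smul_mem' := by
    intro c L h
    simp only [mem_ofPred_eq] at h
    simp [h]

/-- The endomorphism of `E = P ⊕ Pᗮ` which is the rotation `e₀ ↦ e₁ ↦ -e₀` on `P` and `J` on
`Pᗮ`. -/
def extendComplexStructure (P : OrientedPlane E) (e : OrthonormalBasis (Fin 2) ℝ P.plane)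
    (J : Module.End ℝ P.planeᗮ) : Module.End ℝ E :=
  P.plane.subtype ∘ₗ (e.toBasis.constr ℝ ![e 1, -e 0]) ∘ₗ
      (P.plane.orthogonalProjectionOnto : E →ₗ[ℝ] P.plane) +
    P.planeᗮ.subtype ∘ₗ J ∘ₗ (P.planeᗮ.orthogonalProjectionOnto : E →ₗ[ℝ] P.planeᗮ)

/-- For a linear complex structure `J` on `E`, the set of `J`-complex lines, each one oriented by
the bases `(v, J v)`: the set of fibres of the Hopf-like fibration of `J`. -/
def complexLines (J : Module.End ℝ E) : Set (OrientedPlane E) :=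
  {Q | ∀ v : Q.plane, v ≠ 0 → ∃ b : Module.Basis (Fin 2) ℝ Q.plane,
    b 0 = v ∧ (b 1 : E) = J v ∧ b.orientation = Q.orientation}

end OrientedPlane

/-- `S` is near its point `x` a smooth `k`-dimensional submanifold of the vector space `V`: there is
a slice chart, i.e. a local diffeomorphism straightening `S` to a `k`-dimensional subspace. -/
def IsSmoothSubmanifoldNear {V : Type*} [NormedAddCommGroup V] [NormedSpace ℝ V] (k : ℕ)
    (S : Set V) (x : V) : Prop :=
  ∃ (φ : OpenPartialHomeomorph V V) (W : Submodule ℝ V),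
    x ∈ φ.source ∧ ContDiffOn ℝ ∞ φ φ.source ∧ ContDiffOn ℝ ∞ φ.symm φ.target ∧
      Module.finrank ℝ W = k ∧ ∀ y ∈ φ.source, y ∈ S ↔ φ y ∈ W

namespace OrientedPlane

variable {E : Type*} [NormedAddCommGroup E] [InnerProductSpace ℝ E]

/-- `M` is a closed (compact, without boundary) smooth `k`-dimensional submanifold of the
Grassmannian of oriented 2-planes: each of its points lies in a coordinate neighbourhood in which
`M` is, near that point, a smooth `k`-dimensional submanifold. -/
def IsClosedSmoothSubmanifold (k : ℕ) (M : Set (OrientedPlane E)) : Prop :=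
  IsCompact M ∧ ∀ Q ∈ M, ∃ (R : OrientedPlane E) (L : R.Tangent),
    R.graph L = Q ∧ IsSmoothSubmanifoldNear k (R.graph ⁻¹' M) L

end OrientedPlane

/-- `F` is (the set of fibres, i.e. the base space in the Grassmannian, of) a smooth fibration of
the unit sphere `S^(2n+1)` of the `(2n+2)`-dimensional Euclidean space `E` by oriented great
circles.  Here `π` sends a point of the sphere to the fibre through it; its continuity says that the
orientations of the fibres vary continuously.  Local triviality: the sphere is covered by open sets
`φ.source`, each a union of fibres, with diffeomorphisms onto `D × S^1`, with `D` open in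
`ℝ^(2n)`, under which the fibres correspond to the circles `{d} × S^1`. -/
def IsSmoothGreatCircleFibration (n : ℕ) {E : Type*} [NormedAddCommGroup E] [InnerProductSpace ℝ E]
    [Fact (Module.finrank ℝ E = 2 * n + 1 + 1)] (F : Set (OrientedPlane E)) : Prop :=
  ∃ π : sphere (0 : E) 1 → OrientedPlane E,
    Continuous π ∧
    (∀ v : sphere (0 : E) 1, ∀ Q : OrientedPlane E, (Q ∈ F ∧ (v : E) ∈ Q.plane) ↔ Q = π v) ∧
    ∀ v : sphere (0 : E) 1, ∃ φ : OpenPartialHomeomorph (sphere (0 : E) 1)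
        (EuclideanSpace ℝ (Fin (2 * n)) × sphere (0 : EuclideanSpace ℝ (Fin 2)) 1),
      v ∈ φ.source ∧
      (∃ D : Set (EuclideanSpace ℝ (Fin (2 * n))), φ.target = D ×ˢ univ) ∧
      ContMDiffOn (𝓡 (2 * n + 1)) ((𝓡 (2 * n)).prod (𝓡 1)) ∞ φ φ.source ∧
      ContMDiffOn ((𝓡 (2 * n)).prod (𝓡 1)) (𝓡 (2 * n + 1)) ∞ φ.symm φ.target ∧
      ∀ u ∈ φ.source, ∀ w, π w = π u ↔ (w ∈ φ.source ∧ (φ w).1 = (φ u).1)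

/-- `A` has no real eigenvalues. -/
def HasNoRealEigenvalues {V : Type*} [AddCommGroup V] [Module ℝ V] (A : Module.End ℝ V) : Prop :=
  ∀ μ : ℝ, ¬ Module.End.HasEigenvalue A μ

/-- `J = J_A`: a linear complex structure whose complexification is multiplication by `i`, resp.
`-i`, on the generalized eigenspaces of the complexification of `A` for the eigenvalues with
positive, resp. negative, imaginary part.  (If `A` has no real eigenvalues on a finite dimensional
space then these generalized eigenspaces span, so that `J` is unique.) -/
structure IsAssociatedComplexStructure {V : Type*} [AddCommGroup V] [Module ℝ V]
    (A J : Module.End ℝ V) : Prop where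
  mul_self : J * J = -1
  of_im_pos : ∀ μ : ℂ, 0 < μ.im →
    ∀ z ∈ Module.End.maxGenEigenspace (LinearMap.baseChange ℂ A : Module.End ℂ (ℂ ⊗[ℝ] V)) μ,
      LinearMap.baseChange ℂ J z = Complex.I • z
  of_im_neg : ∀ μ : ℂ, μ.im < 0 →
    ∀ z ∈ Module.End.maxGenEigenspace (LinearMap.baseChange ℂ A : Module.End ℂ (ℂ ⊗[ℝ] V)) μ,
      LinearMap.baseChange ℂ J z = -Complex.I • z

/-- `f : [0, ∞) → [0, 1]` is a smooth bump function, equal to `1` near `0` and to `0` for large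
arguments, and slowly varying in the sense that `s |f'(s)| < ε` for all `s ≥ 0`.  (As `f = 1` near
`0`, it is no restriction to have `f` defined on all of `ℝ`.) -/
structure IsSlowBump (ε : ℝ) (f : ℝ → ℝ) : Prop where
  contDiff : ContDiff ℝ ∞ f
  mem_Icc : ∀ s, f s ∈ Icc (0 : ℝ) 1
  eq_one : ∀ᶠ s in 𝓝 0, f s = 1
  eq_zero : ∀ᶠ s in atTop, f s = 0
  slow : ∀ s, 0 ≤ s → s * |deriv f s| < ε

namespace OrientedPlane

variable {E : Type*} [NormedAddCommGroup E] [InnerProductSpace ℝ E]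

/-- `N(x) = f(|x|) A x + (1 - f(|x|)) J x`. -/
def interpolation (P : OrientedPlane E) (A J : Module.End ℝ P.planeᗮ) (f : ℝ → ℝ)
    (x : P.planeᗮ) : P.planeᗮ :=
  f ‖x‖ • A x + (1 - f ‖x‖) • J x

/-- The subset of the Grassmannian which in the coordinate neighbourhood `N(P)` is the graph of
`N(x) = f(|x|) A x + (1 - f(|x|)) J x`, and outside of `N(P)` coincides with the
base space of the Hopf-like fibration of (the extension to `E` of) `J`. -/
def interpolatedBase (P : OrientedPlane E) (e : OrthonormalBasis (Fin 2) ℝ P.plane)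
    (A J : Module.End ℝ P.planeᗮ) (f : ℝ → ℝ) : Set (OrientedPlane E) :=
  P.graph '' {L | L (e 1) = P.interpolation A J f (L (e 0))} ∪
    (complexLines (P.extendComplexStructure e J) \ range P.graph)

end OrientedPlane

end

/-! A map `L : P → Pᗮ` with `L v = 0` for some `v ≠ 0` lies in the bad cone, since the graphs of all
`t L` contain `v`. Hence nonzero elements of `T` are injective. Evaluation at `e 0` is then an
isomorphism `T ≃ Pᗮ` by dimension, so `T` is the graph of some `A`. An eigenvector of `A` for a real
`μ` would give a nonzero element of `T` killing `e 1 - μ • e 0` (`exists_eq_graphSubspace`).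

By the Chinese remainder theorem, `J` can be taken to be a real polynomial in `A`. It therefore
commutes with `A`, and no convex combination `t A + (1 - t) J` has a real eigenvalue
(`IsAssociatedComplexStructure.eq_zero_of_combination`). By compactness `a x + b (t A x + (1 - t) J
x)` has norm at least `c ‖(a, b)‖ ‖x‖`, uniformly in `t`. If `f` varies slowly, letting `t = f ‖x‖`
depend on `x` costs at most half of this (`exists_slow_lower_bound`). Hence for every `(a, b) ≠ 0`
the map `x ↦ a x + b N x` is a diffeomorphism of `Pᗮ`, with inverse smooth in `(a, b)` too
(`exists_contDiffAt_inverse`).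

This is the fibration property. A vector `a e₀ + b e₁ + y` with `y` in `Pᗮ` lies on the graph of `L`
iff `a L e₀ + b L e₁ = y`. So if `(a, b) ≠ 0` it lies on exactly one plane of the family, while
nonzero vectors of `Pᗮ` lie on no graph and on exactly one complex line
(`IsAdapted.existsUnique_mem`). Off `Pᗮ` the smooth inverse gives a trivialization. Near `Pᗮ` the
family consists of complex lines, because `N = J` far out, and an affine chart of projective space
trivializes it.

The base is compact as a continuous image of the sphere. It is a submanifold because it is the graph
of `N` in `N(P)` and locally the set of complex lines elsewhere. Near `P` it is the graph of `A`, so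
its tangent cone is `T`. Slow bumps exist because `s f'(s)` is the derivative with respect to `log
s`, which is small when the transition is spread over a long logarithmic interval. -/

/-! ### Oriented planes through positively oriented frames, and charts. -/

namespace OrientedPlane

variable {E : Type*} [NormedAddCommGroup E] [InnerProductSpace ℝ E]

/-- `(u, w)` is a positively oriented basis of `Q`. -/
def IsFrame (Q : OrientedPlane E) (u w : E) : Prop :=
  ∃ b : Module.Basis (Fin 2) ℝ Q.plane, (b 0 : E) = u ∧ (b 1 : E) = w ∧
    b.orientation = Q.orientation

theorem IsFrame.mem_iff {Q : OrientedPlane E} {u w : E} (h : Q.IsFrame u w) {v : E} :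
    v ∈ Q.plane ↔ ∃ a b : ℝ, v = a • u + b • w := by
  obtain ⟨b, rfl, rfl, -⟩ := h
  constructor
  · intro hv
    refine ⟨b.repr ⟨v, hv⟩ 0, b.repr ⟨v, hv⟩ 1, ?_⟩
    have := congrArg (Subtype.val) (b.sum_repr ⟨v, hv⟩)
    rw [Fin.sum_univ_two] at this
    exact this.symm
  · rintro ⟨s, t, rfl⟩
    exact add_mem (Q.plane.smul_mem _ (b 0).2) (Q.plane.smul_mem _ (b 1).2)

theorem IsFrame.left_mem {Q : OrientedPlane E} {u w : E} (h : Q.IsFrame u w) : u ∈ Q.plane := by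
  obtain ⟨b, rfl, rfl, -⟩ := h; exact (b 0).2

theorem IsFrame.right_mem {Q : OrientedPlane E} {u w : E} (h : Q.IsFrame u w) : w ∈ Q.plane := by
  obtain ⟨b, rfl, rfl, -⟩ := h; exact (b 1).2

theorem IsFrame.coeff_eq_zero {Q : OrientedPlane E} {u w : E} (h : Q.IsFrame u w) {s t : ℝ}
    (hst : s • u + t • w = 0) : s = 0 ∧ t = 0 := by
  obtain ⟨b, rfl, rfl, -⟩ := h
  have h0 : s • b 0 + t • b 1 = 0 := Subtype.ext (by simpa using hst)
  have := Fintype.linearIndependent_iff.1 b.linearIndependent ![s, t]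
    (by simpa [Fin.sum_univ_two] using h0)
  exact ⟨by simpa using this 0, by simpa using this 1⟩

theorem IsFrame.coeff_unique {Q : OrientedPlane E} {u w : E} (h : Q.IsFrame u w) {s t s' t' : ℝ}
    (hst : s • u + t • w = s' • u + t' • w) : s = s' ∧ t = t' := by
  have := h.coeff_eq_zero (s := s - s') (t := t - t')
    (by rw [sub_smul, sub_smul, sub_add_sub_comm, hst, sub_self])
  exact ⟨sub_eq_zero.1 this.1, sub_eq_zero.1 this.2⟩

theorem IsFrame.left_ne_zero {Q : OrientedPlane E} {u w : E} (h : Q.IsFrame u w) : u ≠ 0 := by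
  rintro rfl
  simpa using (h.coeff_eq_zero (s := 1) (t := 0) (by simp)).1

theorem IsFrame.unique {Q Q' : OrientedPlane E} {u w : E} (h : Q.IsFrame u w)
    (h' : Q'.IsFrame u w) : Q = Q' := by
  have hp : Q.plane = Q'.plane := by
    ext v; rw [h.mem_iff, h'.mem_iff]
  obtain ⟨b, hb0, hb1, ho⟩ := h
  obtain ⟨b', hb0', hb1', ho'⟩ := h'
  obtain ⟨p, hQ, o⟩ := Q
  obtain ⟨p', hQ', o'⟩ := Q'
  obtain rfl : p = p' := hp
  have : b = b' := by
    ext i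
    fin_cases i
    · simp [hb0, hb0']
    · simp [hb1, hb1']
  simp only at ho ho'
  rw [← ho, ← ho', this]

theorem IsFrame.change {Q : OrientedPlane E} {u w : E} (h : Q.IsFrame u w) {a b c d : ℝ}
    (hdet : 0 < a * d - b * c) : Q.IsFrame (a • u + b • w) (c • u + d • w) := by
  obtain ⟨e, rfl, rfl, ho⟩ := h
  let f : Fin 2 → Q.plane := ![a • e 0 + b • e 1, c • e 0 + d • e 1]
  have hd : e.det f = a * d - b * c := by
    rw [Module.Basis.det_apply, Matrix.det_fin_two]
    simp [Module.Basis.toMatrix_apply, f]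
    ring
  have hu : IsUnit (e.det f) := by rw [hd]; exact hdet.ne'.isUnit
  obtain ⟨hli, hsp⟩ := e.is_basis_iff_det.2 hu
  refine ⟨Module.Basis.mk hli hsp.ge, by simp [f], by simp [f], ?_⟩
  rw [← ho, eq_comm, Module.Basis.orientation_eq_iff_det_pos, Module.Basis.coe_mk, hd]
  exact hdet

theorem exists_isFrame {u w : E} (h : ∀ s t : ℝ, s • u + t • w = 0 → s = 0 ∧ t = 0) :
    ∃ Q : OrientedPlane E, Q.IsFrame u w := by
  have hli : LinearIndependent ℝ ![u, w] := LinearIndependent.pair_iff.2 h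
  refine ⟨⟨Submodule.span ℝ (range ![u, w]), ?_, (Module.Basis.span hli).orientation⟩,
    Module.Basis.span hli, ?_, ?_, rfl⟩
  · rw [finrank_span_eq_card hli, Fintype.card_fin]
  · rw [Module.Basis.span_apply]; rfl
  · rw [Module.Basis.span_apply]; rfl

theorem isFrame_graph {P : OrientedPlane E} {p q : P.plane} (h : P.IsFrame p q) (L : P.Tangent) :
    (P.graph L).IsFrame (p + L p) (q + L q) := by
  obtain ⟨b, h0, h1, ho⟩ := h
  obtain rfl := Subtype.ext h0
  obtain rfl := Subtype.ext h1
  exact ⟨b.map (P.graphEquiv L), rfl, rfl,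
    (Module.Basis.orientation_map b (P.graphEquiv L)).trans (by rw [ho]; rfl)⟩

/-- There is an element of `Hom(P, Pᗮ)` with prescribed values on a frame. -/
theorem exists_tangent {P : OrientedPlane E} {p q : P.plane} (h : P.IsFrame p q)
    (x y : P.planeᗮ) : ∃ L : P.Tangent, L p = x ∧ L q = y := by
  obtain ⟨b, h0, h1, -⟩ := h
  obtain rfl := Subtype.ext h0
  obtain rfl := Subtype.ext h1
  exact ⟨LinearMap.toContinuousLinearMap (b.constr ℝ ![x, y]), by simp, by simp⟩

theorem tangent_ext {P : OrientedPlane E} {p q : P.plane} (h : P.IsFrame p q)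
    {L L' : P.Tangent} (hp : L p = L' p) (hq : L q = L' q) : L = L' := by
  obtain ⟨b, h0, h1, -⟩ := h
  obtain rfl := Subtype.ext h0
  obtain rfl := Subtype.ext h1
  apply ContinuousLinearMap.coe_injective
  refine b.ext fun i => ?_
  fin_cases i
  · exact hp
  · exact hq

theorem exists_frame (P : OrientedPlane E) : ∃ p q : P.plane, P.IsFrame p q := by
  have := P.finrank_plane
  let b := (Module.finBasisOfFinrankEq ℝ P.plane this).adjustToOrientation P.orientation
  exact ⟨b 0, b 1, b, rfl, rfl, by simp [b]⟩

theorem proj_add (P : OrientedPlane E) (x : P.plane) (y : P.planeᗮ) :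
    P.plane.orthogonalProjectionOnto (x + y : E) = x ∧
      P.planeᗮ.orthogonalProjectionOnto (x + y : E) = y := by
  constructor
  · rw [map_add, Submodule.orthogonalProjectionOnto_mem_subspace_eq_self,
      Submodule.orthogonalProjectionOnto_eq_zero_iff.2 y.2, add_zero]
  · rw [map_add, Submodule.orthogonalProjectionOnto_mem_subspace_eq_self,
      Submodule.orthogonalProjectionOnto_orthogonal_apply_eq_zero x.2, zero_add]

theorem proj_sum (P : OrientedPlane E) (v : E) :
    (P.plane.orthogonalProjectionOnto v : E) + P.planeᗮ.orthogonalProjectionOnto v = v := by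
  exact Submodule.starProjection_add_starProjection_orthogonal (K := P.plane) v

theorem mem_graph_iff {P : OrientedPlane E} {L : P.Tangent} {v : E} :
    v ∈ (P.graph L).plane ↔
      P.planeᗮ.orthogonalProjectionOnto v = L (P.plane.orthogonalProjectionOnto v) := by
  constructor
  · rintro ⟨x, rfl⟩
    rw [graphMap_apply, (P.proj_add _ _).1, (P.proj_add _ _).2]
  · intro h
    refine ⟨P.plane.orthogonalProjectionOnto v, ?_⟩
    rw [graphMap_apply, ← h, P.proj_sum]

theorem graph_injective (P : OrientedPlane E) : Function.Injective P.graph := by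
  intro L L' h
  ext1 x
  have : (x + L x : E) ∈ (P.graph L').plane := h ▸ ⟨x, rfl⟩
  rw [mem_graph_iff, (P.proj_add _ _).1, (P.proj_add _ _).2] at this
  exact this

theorem continuous_graph (P : OrientedPlane E) : Continuous P.graph :=
  continuous_iff_coinduced_le.2 (le_iSup
    (fun P : OrientedPlane E => TopologicalSpace.coinduced P.graph inferInstance) P)

/-- An oriented plane with a frame that projects to a positive pair of vectors of `P` is
a graph over `P`. -/
theorem IsFrame.mem_range_graph {P Q : OrientedPlane E} {p q : P.plane} (h : P.IsFrame p q)
    {u w : E} (hQ : Q.IsFrame u w) {a b c d : ℝ}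
    (hu : P.plane.orthogonalProjectionOnto u = a • p + b • q)
    (hw : P.plane.orthogonalProjectionOnto w = c • p + d • q)
    (hdet : 0 < a * d - b * c) : ∃ L, P.graph L = Q ∧
      (L p = (a * d - b * c)⁻¹ • P.planeᗮ.orthogonalProjectionOnto (d • u - b • w)) ∧
      (L q = (a * d - b * c)⁻¹ • P.planeᗮ.orthogonalProjectionOnto (a • w - c • u)) := by
  set D := a * d - b * c with hD
  -- Cramer's rule for the system `u = a (p + L p) + b (q + L q)`, `w = c (p + L p) + d (q + L q)`,
  -- projected to `Pᗮ`.
  obtain ⟨L, hp, hq⟩ := exists_tangent h (D⁻¹ • P.planeᗮ.orthogonalProjectionOnto (d • u - b • w))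
    (D⁻¹ • P.planeᗮ.orthogonalProjectionOnto (a • w - c • u))
  refine ⟨L, ?_, hp, hq⟩
  have hF := (isFrame_graph h L).change hdet
  refine hF.unique ?_
  have key : ∀ s t : ℝ, ∀ v : E, P.plane.orthogonalProjectionOnto v = s • p + t • q →
      P.planeᗮ.orthogonalProjectionOnto v = s • L p + t • L q →
      s • (p + L p : E) + t • (q + L q : E) = v := by
    intro s t v h1 h2
    rw [← P.proj_sum v, h1, h2]
    push_cast
    module
  have e1 : P.planeᗮ.orthogonalProjectionOnto u = a • L p + b • L q := by
    rw [hp, hq]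
    simp only [map_sub, map_smul]
    match_scalars <;> field_simp <;> ring
  have e2 : P.planeᗮ.orthogonalProjectionOnto w = c • L p + d • L q := by
    rw [hp, hq]
    simp only [map_sub, map_smul]
    match_scalars <;> field_simp <;> ring
  rw [key a b u hu e1, key c d w hw e2]
  exact hQ

/-- A family of oriented planes with continuous frames is continuous. -/
theorem continuousAt_of_isFrame {X : Type*} [TopologicalSpace X] {π : X → OrientedPlane E}
    {u w : X → E} {x₀ : X} (hu : ContinuousAt u x₀) (hw : ContinuousAt w x₀)
    (h : ∀ᶠ x in 𝓝 x₀, (π x).IsFrame (u x) (w x)) : ContinuousAt π x₀ := by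
  obtain ⟨b, hb0, hb1, ho⟩ := h.self_of_nhds
  generalize π x₀ = P at b ho ⊢
  have hP : P.IsFrame (b 0) (b 1) := ⟨b, rfl, rfl, ho⟩
  let pr : E →L[ℝ] P.plane := P.plane.orthogonalProjectionOnto
  let c : Fin 2 → P.plane →L[ℝ] ℝ := fun i => LinearMap.toContinuousLinearMap (b.coord i)
  have hrep : ∀ v : P.plane, v = c 0 v • b 0 + c 1 v • b 1 := fun v => by
    rw [← Fin.sum_univ_two (fun i => c i v • b i)]
    exact (b.sum_repr v).symm
  let D : X → ℝ := fun x => c 0 (pr (u x)) * c 1 (pr (w x)) - c 1 (pr (u x)) * c 0 (pr (w x))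
  have hcu : ∀ i, ContinuousAt (fun x => c i (pr (u x))) x₀ := fun i =>
    (c i).continuous.continuousAt.comp (pr.continuous.continuousAt.comp hu)
  have hcw : ∀ i, ContinuousAt (fun x => c i (pr (w x))) x₀ := fun i =>
    (c i).continuous.continuousAt.comp (pr.continuous.continuousAt.comp hw)
  have hD : ContinuousAt D x₀ := ((hcu 0).mul (hcw 1)).sub ((hcu 1).mul (hcw 0))
  -- The chart is the one centred at `π x₀` itself, so the determinant at `x₀` is `1` and stays
  -- positive nearby.
  have hD0 : 0 < D x₀ := by
    have h0 : pr (u x₀) = b 0 := by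
      rw [← hb0]; exact Submodule.orthogonalProjectionOnto_mem_subspace_eq_self _
    have h1 : pr (w x₀) = b 1 := by
      rw [← hb1]; exact Submodule.orthogonalProjectionOnto_mem_subspace_eq_self _
    simp [D, h0, h1, c]
  let K : (ℝ × ℝ × ℝ × ℝ) → E → E → P.planeᗮ × P.planeᗮ := fun s u w =>
    ((s.1 * s.2.2.2 - s.2.1 * s.2.2.1)⁻¹ • P.planeᗮ.orthogonalProjectionOnto
        (s.2.2.2 • u - s.2.1 • w),
     (s.1 * s.2.2.2 - s.2.1 * s.2.2.1)⁻¹ • P.planeᗮ.orthogonalProjectionOnto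
        (s.1 • w - s.2.2.1 • u))
  let H : P.planeᗮ × P.planeᗮ → P.Tangent := fun xy =>
    (c 0).smulRight xy.1 + (c 1).smulRight xy.2
  have hH0 : ∀ xy, H xy (b 0) = xy.1 := fun xy => by simp [H, c]
  have hH1 : ∀ xy, H xy (b 1) = xy.2 := fun xy => by simp [H, c]
  have hHc : Continuous H := by
    refine Continuous.add ?_ ?_
    · exact (ContinuousLinearMap.smulRightL ℝ P.plane P.planeᗮ (c 0)).continuous.comp
        continuous_fst
    · exact (ContinuousLinearMap.smulRightL ℝ P.plane P.planeᗮ (c 1)).continuous.comp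
        continuous_snd
  let Λ : X → P.Tangent := fun x =>
    H ((D x)⁻¹ • P.planeᗮ.orthogonalProjectionOnto (c 1 (pr (w x)) • u x - c 1 (pr (u x)) • w x),
      (D x)⁻¹ • P.planeᗮ.orthogonalProjectionOnto (c 0 (pr (u x)) • w x - c 0 (pr (w x)) • u x))
  have hΛ : ContinuousAt Λ x₀ := by
    refine hHc.continuousAt.comp (ContinuousAt.prodMk ?_ ?_)
    · exact (hD.inv₀ hD0.ne').smul ((ContinuousLinearMap.continuous _).continuousAt.comp
        (((hcw 1).smul hu).sub ((hcu 1).smul hw)))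
    · exact (hD.inv₀ hD0.ne').smul ((ContinuousLinearMap.continuous _).continuousAt.comp
        (((hcu 0).smul hw).sub ((hcw 0).smul hu)))
  have heq : ∀ᶠ x in 𝓝 x₀, π x = P.graph (Λ x) := by
    filter_upwards [h, hD.eventually (lt_mem_nhds hD0)] with x hx hDx
    obtain ⟨L, hL, hLp, hLq⟩ := hP.mem_range_graph hx (hrep (pr (u x))) (hrep (pr (w x))) hDx
    rw [← hL]
    congr 1
    refine tangent_ext hP ?_ ?_
    · rw [hLp]; exact (hH0 (_, _)).symm
    · rw [hLq]; exact (hH1 (_, _)).symm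
  exact ((P.continuous_graph.continuousAt.comp hΛ).congr (heq.mono fun x hx => hx.symm))

end OrientedPlane

/-! ### The complex structure `J_A` as a real polynomial in `A`. -/

section ComplexStructure

open Polynomial

variable {V : Type*} [AddCommGroup V] [Module ℝ V]

theorem aeval_baseChange (A : Module.End ℝ V) (p : ℝ[X]) :
    (LinearMap.baseChange ℂ (aeval A p) : Module.End ℂ (ℂ ⊗[ℝ] V)) =
      aeval (LinearMap.baseChange ℂ A : Module.End ℂ (ℂ ⊗[ℝ] V)) (p.map (algebraMap ℝ ℂ)) := by
  rw [aeval_map_algebraMap]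
  exact (aeval_algHom_apply (Module.End.baseChangeHom ℝ ℂ V) A p).symm

/-- Bézout writes `g` as a combination of `(X - μ) ^ k` and `g * h`, and both kill `z`. Thus
generalized eigenvectors see only the factor of an annihilating polynomial that carries their
eigenvalue. -/
theorem aeval_apply_eq_zero_of_isCoprime {W : Type*} [AddCommGroup W] [Module ℂ W]
    {B : Module.End ℂ W} {g h : ℂ[X]} (hB : aeval B (g * h) = 0) {μ : ℂ} {k : ℕ}
    (hc : IsCoprime ((X - C μ) ^ k) h) {z : W} (hz : ((B - algebraMap ℂ _ μ) ^ k) z = 0) :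
    aeval B g z = 0 := by
  obtain ⟨a, b, hab⟩ := hc
  have h1 : g = (a * g) * (X - C μ) ^ k + b * (g * h) := by
    linear_combination (-g) * hab
  rw [h1, map_add, map_mul, map_mul (aeval B) b, hB, mul_zero, add_zero, Module.End.mul_apply,
    map_pow, map_sub, aeval_X, aeval_C, hz, map_zero]

theorem isCoprime_prod_X_sub_C {S T : Finset ℂ} (h : ∀ x ∈ S, ∀ y ∈ T, x ≠ y) :
    IsCoprime (∏ x ∈ S, (X - C x)) (∏ y ∈ T, (X - C y)) :=
  IsCoprime.prod_left fun x hx => IsCoprime.prod_right fun y hy =>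
    isCoprime_X_sub_C_of_isUnit_sub (sub_ne_zero.2 (h x hx y hy)).isUnit

/-- For a real polynomial `χ` without real roots there is a real polynomial which is congruent to
`i`, resp. `-i`, modulo the part of `χ` with roots in the upper, resp. lower, half plane. -/
theorem exists_real_polynomial {χ : ℝ[X]} (hχ : χ.Monic) (h0 : ∀ x : ℝ, χ.eval x ≠ 0) :
    ∃ (p : ℝ[X]) (q q' : ℂ[X]), χ.map (algebraMap ℝ ℂ) ∣ q * q' ∧
      q ∣ p.map (algebraMap ℝ ℂ) - C Complex.I ∧ q' ∣ p.map (algebraMap ℝ ℂ) + C Complex.I ∧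
      (∀ μ : ℂ, 0 < μ.im → ∀ k, IsCoprime ((X - C μ) ^ k) q') ∧
      (∀ μ : ℂ, μ.im < 0 → ∀ k, IsCoprime ((X - C μ) ^ k) q) := by
  classical
  set χ' := χ.map (algebraMap ℝ ℂ) with hχ'
  have hm' : χ'.Monic := hχ.map _
  have hconj : ∀ p : ℝ[X], (p.map (algebraMap ℝ ℂ)).map (starRingEnd ℂ) =
      p.map (algebraMap ℝ ℂ) := fun p => by
    rw [Polynomial.map_map]; congr 1; ext x; simp
  let S : Finset ℂ := χ'.roots.toFinset.filter fun z => 0 < z.im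
  let S' : Finset ℂ := S.image (starRingEnd ℂ)
  have hS : ∀ x ∈ S, 0 < x.im := fun x hx => (Finset.mem_filter.1 hx).2
  have hS' : ∀ x ∈ S', x.im < 0 := fun x hx => by
    obtain ⟨y, hy, rfl⟩ := Finset.mem_image.1 hx
    simpa using hS y hy
  let r : ℂ[X] := ∏ x ∈ S, (X - C x)
  let r' : ℂ[X] := ∏ x ∈ S', (X - C x)
  have hrr' : r.map (starRingEnd ℂ) = r' := by
    simp only [r, r', S', Polynomial.map_prod]
    rw [Finset.prod_image fun x _ y _ h => (starRingEnd ℂ).injective h]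
    simp
  -- The products `r`, `r'` ignore multiplicities. The exponent `N` exceeds or equals every one of
  -- them.
  let N := χ'.natDegree
  have hconj_q : (r ^ N).map (starRingEnd ℂ) = r' ^ N := by rw [Polynomial.map_pow, hrr']
  have hcop : IsCoprime (r ^ N) (r' ^ N) :=
    (isCoprime_prod_X_sub_C fun x hx y hy h => by
      have := hS x hx; have := hS' y hy; rw [h] at *; linarith).pow
  obtain ⟨u, v, huv⟩ := hcop
  -- Chinese remainder theorem: since `u r^N + v r'^N = 1`, this is `i` modulo `r^N` and `-i` modulo
  -- `r'^N`.
  let p₀ : ℂ[X] := C Complex.I * (v * r' ^ N - u * r ^ N)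
  have hI : (C Complex.I : ℂ[X]) ^ 2 = -1 := by rw [← C_pow, Complex.I_sq]; simp
  have d1 : r ^ N ∣ p₀ - C Complex.I :=
    ⟨-2 * C Complex.I * u, by simp only [p₀]; linear_combination (C Complex.I) * huv⟩
  have d2 : r' ^ N ∣ p₀ + C Complex.I :=
    ⟨2 * C Complex.I * v, by simp only [p₀]; linear_combination (-C Complex.I) * huv⟩
  clear_value p₀
  have hr2 : (r' ^ N).map (starRingEnd ℂ) = r ^ N := by
    rw [← hconj_q, Polynomial.map_map]
    convert! Polynomial.map_id
    ext z
    simp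
  -- Conjugation exchanges `r^N` with `r'^N` and `i` with `-i`. So the conjugate of `p₀` satisfies
  -- the same two congruences, and so does the average of both, which has real coefficients.
  have d3 : r' ^ N ∣ p₀.map (starRingEnd ℂ) + C Complex.I := by
    have := Polynomial.map_dvd (starRingEnd ℂ) d1
    rwa [hconj_q, Polynomial.map_sub, map_C, Complex.conj_I, C_neg, sub_neg_eq_add] at this
  have d4 : r ^ N ∣ p₀.map (starRingEnd ℂ) - C Complex.I := by
    have := Polynomial.map_dvd (starRingEnd ℂ) d2
    rwa [hr2, Polynomial.map_add, map_C, Complex.conj_I, C_neg, ← sub_eq_add_neg] at this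
  have hlift : C (1 / 2 : ℂ) * (p₀ + p₀.map (starRingEnd ℂ)) ∈ lifts (algebraMap ℝ ℂ) := by
    rw [lifts_iff_coeff_lifts]
    intro n
    refine ⟨(p₀.coeff n).re, ?_⟩
    rw [coeff_C_mul, coeff_add, coeff_map, Complex.add_conj]
    simp
  obtain ⟨p, hp⟩ := (mem_lifts _).1 hlift
  have hhalf : (C (1 / 2 : ℂ) : ℂ[X]) * 2 = 1 := by
    rw [← C_ofNat, ← C_mul]; norm_num
  refine ⟨p, r ^ N, r' ^ N, ?_, ?_, ?_, ?_, ?_⟩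
  · have hspl : χ' = (χ'.roots.map fun a => X - C a).prod :=
      ((IsAlgClosed.splits χ').eq_prod_roots_of_monic hm')
    have hcard : χ'.roots.card = N := (IsAlgClosed.splits χ').natDegree_eq_card_roots.symm
    -- Both sides are now products over the roots of `χ'` with multiplicity, so it suffices that
    -- each `X - z` divides `r * r'`.
    rw [← mul_pow, ← hcard]
    conv_lhs => rw [hspl]
    rw [← Multiset.prod_replicate, ← Multiset.map_const']
    refine Multiset.prod_dvd_prod_of_dvd _ _ fun z hz => ?_
    have hz0 : χ'.eval z = 0 := (mem_roots'.1 hz).2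
    rcases lt_trichotomy 0 z.im with h | h | h
    · exact dvd_mul_of_dvd_left (Finset.dvd_prod_of_mem _
        (Finset.mem_filter.2 ⟨Multiset.mem_toFinset.2 hz, h⟩)) _
    · exfalso
      have hzr : z = (algebraMap ℝ ℂ) z.re := Complex.ext (by simp) (by simp [h.symm])
      rw [hzr, hχ', eval_map_algebraMap, aeval_algebraMap_apply] at hz0
      simp only [Complex.coe_algebraMap, Complex.ofReal_eq_zero] at hz0
      exact h0 z.re hz0
    · refine dvd_mul_of_dvd_right (Finset.dvd_prod_of_mem _ (Finset.mem_image.2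
        ⟨starRingEnd ℂ z, Finset.mem_filter.2 ⟨Multiset.mem_toFinset.2
          (mem_roots'.2 ⟨hm'.ne_zero, ?_⟩), by simpa using h⟩, by simp⟩)) _
      have hc := hconj χ
      rw [← hχ'] at hc
      rw [IsRoot, ← hc, eval_map_apply, hz0, map_zero]
  · rw [hp]
    have : C (1 / 2 : ℂ) * (p₀ + p₀.map (starRingEnd ℂ)) - C Complex.I =
      C (1 / 2 : ℂ) * ((p₀ - C Complex.I) + (p₀.map (starRingEnd ℂ) - C Complex.I)) := by
      linear_combination (C Complex.I) * hhalf
    rw [this]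
    exact dvd_mul_of_dvd_right (dvd_add d1 d4) _
  · rw [hp]
    have : C (1 / 2 : ℂ) * (p₀ + p₀.map (starRingEnd ℂ)) + C Complex.I =
      C (1 / 2 : ℂ) * ((p₀ + C Complex.I) + (p₀.map (starRingEnd ℂ) + C Complex.I)) := by
      linear_combination (-C Complex.I) * hhalf
    rw [this]
    exact dvd_mul_of_dvd_right (dvd_add d2 d3) _
  · intro μ hμ k
    refine IsCoprime.pow ?_
    simpa using isCoprime_prod_X_sub_C (S := {μ}) (T := S') fun x hx y hy h => by
      rw [Finset.mem_singleton] at hx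
      have := hS' y hy; rw [← h, hx] at this; linarith
  · intro μ hμ k
    refine IsCoprime.pow ?_
    simpa using isCoprime_prod_X_sub_C (S := {μ}) (T := S) fun x hx y hy h => by
      rw [Finset.mem_singleton] at hx
      have := hS y hy; rw [← h, hx] at this; linarith

/-- `J = p(A)` for the polynomial `p` of `exists_real_polynomial`. Then `J² = -1` because the
characteristic polynomial divides `p² + 1 = (p - i)(p + i)`, and `J` commutes with `A`, which the
later estimates need. -/
theorem exists_isAssociatedComplexStructure [FiniteDimensional ℝ V] {A : Module.End ℝ V}
    (hA : HasNoRealEigenvalues A) :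
    ∃ J, IsAssociatedComplexStructure A J ∧ Commute A J := by
  obtain ⟨p, q, q', hχ, hq, hq', hc, hc'⟩ := exists_real_polynomial (LinearMap.charpoly_monic A)
    fun x hx => hA x ((Module.End.hasEigenvalue_iff_isRoot_charpoly A x).2 hx)
  set B : Module.End ℂ (ℂ ⊗[ℝ] V) := LinearMap.baseChange ℂ A with hB
  have hqq : aeval B (q * q') = 0 := by
    obtain ⟨s, hs⟩ := hχ
    rw [hs, map_mul, ← aeval_baseChange, LinearMap.aeval_self_charpoly, LinearMap.baseChange_zero,
      zero_mul]
  refine ⟨aeval A p, ⟨?_, ?_, ?_⟩, ?_⟩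
  · have hd : A.charpoly ∣ p * p + 1 := by
      rw [← Polynomial.map_dvd_map' (algebraMap ℝ ℂ)]
      refine hχ.trans ?_
      have hI : (C Complex.I : ℂ[X]) ^ 2 = -1 := by rw [← C_pow, Complex.I_sq]; simp
      convert mul_dvd_mul hq hq' using 1
      simp only [Polynomial.map_add, Polynomial.map_mul, Polynomial.map_one]
      linear_combination hI
    obtain ⟨s, hs⟩ := hd
    rw [← map_mul, ← add_eq_zero_iff_eq_neg, ← map_one (aeval A : ℝ[X] →ₐ[ℝ] Module.End ℝ V), ← map_add, hs, map_mul,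
      LinearMap.aeval_self_charpoly, zero_mul]
  · intro μ hμ z hz
    obtain ⟨k, hk⟩ := (Module.End.mem_maxGenEigenspace _ _ _).1 hz
    have h0 := aeval_apply_eq_zero_of_isCoprime hqq (hc μ hμ k) hk
    obtain ⟨s, hs⟩ := hq
    rw [aeval_baseChange, ← sub_eq_zero]
    have : aeval B (p.map (algebraMap ℝ ℂ) - C Complex.I) z = 0 := by
      rw [hs, mul_comm, map_mul, Module.End.mul_apply, h0, map_zero]
    simpa using this
  · intro μ hμ z hz
    obtain ⟨k, hk⟩ := (Module.End.mem_maxGenEigenspace _ _ _).1 hz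
    have h0 := aeval_apply_eq_zero_of_isCoprime (mul_comm q q' ▸ hqq) (hc' μ hμ k) hk
    obtain ⟨s, hs⟩ := hq'
    rw [aeval_baseChange, ← sub_eq_zero]
    have : aeval B (p.map (algebraMap ℝ ℂ) + C Complex.I) z = 0 := by
      rw [hs, mul_comm, map_mul, Module.End.mul_apply, h0, map_zero]
    simpa using this
  · have := (Commute.all (X : ℝ[X]) p).map (aeval A)
    rwa [aeval_X] at this

theorem IsAssociatedComplexStructure.apply_apply {A J : Module.End ℝ V}
    (h : IsAssociatedComplexStructure A J) (x : V) : J (J x) = -x :=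
  DFunLike.congr_fun h.mul_self x

theorem eq_zero_of_complexStructure_eq_smul {J : Module.End ℝ V} (hJ : ∀ x, J (J x) = -x) {x : V}
    {c : ℝ} (h : J x = c • x) : x = 0 := by
  have h1 := hJ x
  rw [h, map_smul, h, smul_smul] at h1
  have h2 : (c * c + 1) • x = 0 := by rw [add_smul, h1, one_smul, neg_add_cancel]
  exact (smul_eq_zero.1 h2).resolve_left (by nlinarith [mul_self_nonneg c])

/-- On a vector `A` cannot act as a complex number in the closed lower half plane. -/
theorem IsAssociatedComplexStructure.eq_zero_of_apply_eq {A J : Module.End ℝ V}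
    (h : IsAssociatedComplexStructure A J) (hA : HasNoRealEigenvalues A) (hc : Commute A J)
    {x : V} {α β : ℝ} (hβ : β ≤ 0) (hx : A x = α • x + β • J x) : x = 0 := by
  rcases hβ.eq_or_lt with rfl | hβ
  · by_contra hx0
    exact hA α (Module.End.hasEigenvalue_of_hasEigenvector
      ⟨Module.End.mem_eigenspace_iff.2 (by simpa using hx), hx0⟩)
  · have hJ := h.apply_apply
    have hAJ : A (J x) = α • J x - β • x := by
      have : A (J x) = J (A x) := DFunLike.congr_fun hc.eq x
      rw [this, hx, map_add, map_smul, map_smul, hJ, smul_neg, sub_eq_add_neg]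
    -- `x - i J x` is an `i`-eigenvector of `J` and an eigenvector of `A` for `α + i β`. As `β < 0`,
    -- `J` also acts on it as `-i`, so it vanishes, and its real part is `x`.
    let z : ℂ ⊗[ℝ] V := 1 ⊗ₜ x - Complex.I ⊗ₜ J x
    have hJz : LinearMap.baseChange ℂ J z = Complex.I • z := by
      simp only [z, map_sub, LinearMap.baseChange_tmul, hJ, smul_sub, TensorProduct.smul_tmul',
        smul_eq_mul, Complex.I_mul_I, TensorProduct.tmul_neg, mul_one, TensorProduct.neg_tmul]
      abel
    have hAz : LinearMap.baseChange ℂ A z = (⟨α, β⟩ : ℂ) • z := by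
      have e1 : (⟨α, β⟩ : ℂ) = α • 1 + β • Complex.I := by apply Complex.ext <;> simp
      have e2 : (⟨α, β⟩ : ℂ) * Complex.I = α • Complex.I - β • 1 := by apply Complex.ext <;> simp
      simp only [z, map_sub, LinearMap.baseChange_tmul, hx, hAJ, smul_sub, TensorProduct.smul_tmul',
        smul_eq_mul, mul_one, e2]
      rw [e1]
      simp only [TensorProduct.tmul_add, TensorProduct.tmul_sub, TensorProduct.add_tmul,
        TensorProduct.sub_tmul, TensorProduct.tmul_smul, TensorProduct.smul_tmul']
      abel
    have hz := h.of_im_neg ⟨α, β⟩ hβ z (Module.End.mem_maxGenEigenspace _ _ _ |>.2 ⟨1, by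
      simp [hAz]⟩)
    have hz0 : z = 0 := by
      rw [hJz] at hz
      have h2 : (2 * Complex.I) • z = 0 := by
        rw [two_mul, add_smul]
        nth_rewrite 2 [hz]
        rw [neg_smul, add_neg_cancel]
      exact (smul_eq_zero.1 h2).resolve_left (by simp)
    have := congrArg (TensorProduct.lid ℝ V ∘ LinearMap.rTensor V Complex.reLm) hz0
    simpa [z] using this

/-- Solving for `A x` gives `A x = α x + β J x` with `β = -(1 - t) / t ≤ 0`, which
`IsAssociatedComplexStructure.eq_zero_of_apply_eq` excludes. For `t = 0` only `J` is left, and it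
has no real eigenvalue. -/
theorem IsAssociatedComplexStructure.eq_zero_of_combination {A J : Module.End ℝ V}
    (h : IsAssociatedComplexStructure A J) (hA : HasNoRealEigenvalues A) (hc : Commute A J)
    {t : ℝ} (ht : t ∈ Icc (0 : ℝ) 1) {a b : ℝ} (hab : a ≠ 0 ∨ b ≠ 0) {x : V}
    (hx : a • x + b • (t • A x + (1 - t) • J x) = 0) : x = 0 := by
  by_cases hb : b = 0
  · subst hb
    simpa [hab.resolve_right (by simp)] using hx
  · have h1 : t • A x + (1 - t) • J x = (-a / b) • x := by
      have : b • (t • A x + (1 - t) • J x) = b • ((-a / b) • x) := by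
        rw [smul_smul, mul_div_cancel₀ _ hb, neg_smul]
        exact eq_neg_of_add_eq_zero_right hx
      exact smul_right_injective V hb this
    rcases ht.1.eq_or_lt with rfl | h0
    · exact eq_zero_of_complexStructure_eq_smul h.apply_apply (by simpa using h1)
    · refine h.eq_zero_of_apply_eq hA hc (α := t⁻¹ * (-a / b)) (β := -(t⁻¹ * (1 - t))) ?_ ?_
      · have := ht.2
        have : 0 ≤ t⁻¹ * (1 - t) := mul_nonneg (inv_nonneg.2 h0.le) (by linarith)
        linarith
      · have h2 : t⁻¹ • (t • A x) = t⁻¹ • ((-a / b) • x - (1 - t) • J x) := by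
          rw [← h1, add_sub_cancel_right]
        rw [smul_smul, inv_mul_cancel₀ h0.ne', one_smul] at h2
        rw [h2]
        module

end ComplexStructure

/-! ### Slowly varying bump functions. -/

section SlowBump

/-- Mean value theorem: the intermediate point is at least `r`, so `r |f'(s)| ≤ s |f'(s)| < ε`. This
is why the weight is the smaller radius. -/
theorem IsSlowBump.abs_sub_mul_le {ε : ℝ} {f : ℝ → ℝ} (hf : IsSlowBump ε f) {r r' : ℝ} (hr : 0 ≤ r)
    (hrr : r ≤ r') : |f r' - f r| * r ≤ ε * (r' - r) := by
  rcases hrr.eq_or_lt with rfl | hlt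
  · simp
  have hd : Differentiable ℝ f := hf.contDiff.differentiable (by simp)
  obtain ⟨s, hs, hs'⟩ := exists_deriv_eq_slope f hlt hd.continuous.continuousOn
    hd.differentiableOn
  have h0 : 0 < r' - r := sub_pos.2 hlt
  have h1 : f r' - f r = deriv f s * (r' - r) := by rw [hs']; field_simp
  have h2 := hf.slow s (hr.trans hs.1.le)
  rw [h1, abs_mul, abs_of_pos h0, mul_right_comm]
  refine mul_le_mul_of_nonneg_right ?_ h0.le
  have := mul_le_mul_of_nonneg_right hs.1.le (abs_nonneg (deriv f s))
  linarith

theorem exists_abs_deriv_smoothTransition_le :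
    ∃ C : ℝ, 0 < C ∧ ∀ x, |deriv Real.smoothTransition x| ≤ C := by
  have hc : Continuous (deriv Real.smoothTransition) :=
    (Real.smoothTransition.contDiff (n := ⊤)).continuous_deriv (by simp)
  obtain ⟨C, hC⟩ := (isCompact_Icc (a := (0 : ℝ)) (b := 1)).exists_bound_of_continuousOn
    hc.continuousOn
  refine ⟨max C 1, by positivity, fun x => ?_⟩
  by_cases hx : x ∈ Icc (0 : ℝ) 1
  · exact (hC x hx).trans (le_max_left _ _)
  · have : deriv Real.smoothTransition x = 0 := by
      rw [mem_Icc, not_and_or, not_le, not_le] at hx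
      rcases hx with hx | hx
      · have : Real.smoothTransition =ᶠ[𝓝 x] fun _ => 0 := by
          filter_upwards [gt_mem_nhds hx] with y hy
          exact Real.smoothTransition.zero_of_nonpos hy.le
        rw [this.deriv_eq, deriv_const]
      · have : Real.smoothTransition =ᶠ[𝓝 x] fun _ => 1 := by
          filter_upwards [lt_mem_nhds hx] with y hy
          exact Real.smoothTransition.one_of_one_le hy.le
        rw [this.deriv_eq, deriv_const]
    rw [this, abs_zero]
    positivity

theorem exists_isSlowBump {ε δ : ℝ} (hε : 0 < ε) (hδ : 0 < δ) :
    ∃ f, IsSlowBump ε f ∧ ∀ s, δ ≤ s → f s = 0 := by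
  obtain ⟨C, hC0, hC⟩ := exists_abs_deriv_smoothTransition_le
  -- `K` is the length of the transition on the scale of `log s²`; the resulting bound on `s
  -- |f'(s)|` is `2 C / K`.
  obtain ⟨K, hK, hK0⟩ : ∃ K : ℝ, 2 * C / K < ε ∧ 0 < K :=
    ⟨4 * C / ε, by rw [div_lt_iff₀ (by positivity)]; field_simp; linarith, by positivity⟩
  -- `η` removes the singularity of the logarithm at `0`. It is chosen so that `s² < η` gives `s² +
  -- η < δ² e^(-K)`, hence `φ s ≥ 1` near `0`.
  let η : ℝ := δ ^ 2 * Real.exp (-K) / 2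
  have hη : 0 < η := by positivity
  let φ : ℝ → ℝ := fun s => (Real.log (δ ^ 2) - Real.log (s ^ 2 + η)) / K
  have hpos : ∀ s : ℝ, 0 < s ^ 2 + η := fun s => by positivity
  have hφ : ContDiff ℝ ∞ φ := by
    refine (contDiff_const.sub (ContDiff.log ?_ fun s => (hpos s).ne')).div_const _
    fun_prop
  have hφd : ∀ s, HasDerivAt φ (-(2 * s / (s ^ 2 + η)) / K) s := fun s => by
    have h1 : HasDerivAt (fun s : ℝ => s ^ 2 + η) (2 * s) s := by
      simpa using (hasDerivAt_pow 2 s).add_const η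
    have := ((h1.log (hpos s).ne').const_sub (Real.log (δ ^ 2))).div_const K
    exact this
  have hzero : ∀ s, δ ≤ s → Real.smoothTransition (φ s) = 0 := fun s hs => by
    refine Real.smoothTransition.zero_of_nonpos (div_nonpos_of_nonpos_of_nonneg ?_ hK0.le)
    have : Real.log (δ ^ 2) ≤ Real.log (s ^ 2 + η) :=
      Real.log_le_log (by positivity) (by nlinarith)
    linarith
  refine ⟨fun s => Real.smoothTransition (φ s), ⟨Real.smoothTransition.contDiff.comp hφ,
    fun s => ⟨Real.smoothTransition.nonneg _, Real.smoothTransition.le_one _⟩, ?_, ?_, ?_⟩, hzero⟩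
  · have : ∀ᶠ s : ℝ in 𝓝 0, s ^ 2 < η :=
      (continuous_pow 2).continuousAt.eventually (gt_mem_nhds (by simpa using hη))
    filter_upwards [this] with s hs
    refine Real.smoothTransition.one_of_one_le ?_
    rw [le_div_iff₀ hK0, one_mul]
    have h1 : Real.log (s ^ 2 + η) ≤ Real.log (δ ^ 2 * Real.exp (-K)) :=
      Real.log_le_log (hpos s) (by simp only [η] at hs ⊢; linarith)
    rw [Real.log_mul (by positivity) (by positivity), Real.log_exp] at h1
    linarith
  · filter_upwards [eventually_ge_atTop δ] with s hs using hzero s hs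
  · intro s hs
    have hd : HasDerivAt (fun s => Real.smoothTransition (φ s))
        (deriv Real.smoothTransition (φ s) * (-(2 * s / (s ^ 2 + η)) / K)) s :=
      HasDerivAt.comp s ((Real.smoothTransition.contDiff (n := ⊤)).differentiable (by simp)
        (φ s)).hasDerivAt (hφd s)
    rw [hd.deriv, abs_mul]
    have h2 : |-(2 * s / (s ^ 2 + η)) / K| = 2 * s / (s ^ 2 + η) / K := by
      rw [neg_div, abs_neg, abs_of_nonneg (by have := hpos s; positivity)]
    rw [h2]
    have h3 : s * (2 * s / (s ^ 2 + η) / K) ≤ 2 / K := by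
      rw [← mul_div_assoc]
      refine div_le_div_of_nonneg_right ?_ hK0.le
      rw [← mul_div_assoc, div_le_iff₀ (hpos s)]
      nlinarith
    have h4 : 0 ≤ s * (2 * s / (s ^ 2 + η) / K) := by have := hpos s; positivity
    calc s * (|deriv Real.smoothTransition (φ s)| * (2 * s / (s ^ 2 + η) / K))
        = |deriv Real.smoothTransition (φ s)| * (s * (2 * s / (s ^ 2 + η) / K)) := by ring
      _ ≤ C * (2 / K) := mul_le_mul (hC _) h3 h4 hC0.le
      _ = 2 * C / K := by ring
      _ < ε := hK

end SlowBump

/-! ### The maps `x ↦ a x + b N x` are diffeomorphisms. -/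

section Interpolation

/-- Expansion bounds pass to difference quotients and hence to the derivative. With `k > 0` this
makes derivatives injective. -/
theorem HasFDerivAt.le_norm_apply {V : Type*} [NormedAddCommGroup V] [NormedSpace ℝ V]
    {G : V → V} {G' : V →L[ℝ] V} {x : V} (h : HasFDerivAt G G' x)
    {k : ℝ} (hk : ∀ y, k * ‖y - x‖ ≤ ‖G y - G x‖) (v : V) : k * ‖v‖ ≤ ‖G' v‖ := by
  have h1 := (h.hasLineDerivAt v).tendsto_slope_zero_right.norm
  refine ge_of_tendsto h1 ?_
  filter_upwards [self_mem_nhdsWithin] with t ht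
  have ht : 0 < t := ht
  have := hk (x + t • v)
  rw [add_sub_cancel_left, norm_smul, Real.norm_of_nonneg ht.le] at this
  rw [norm_smul, norm_inv, Real.norm_of_nonneg ht.le, ← div_eq_inv_mul, le_div_iff₀ ht]
  linarith

variable {V : Type*} [NormedAddCommGroup V] [InnerProductSpace ℝ V] [FiniteDimensional ℝ V]

/-- `N(x) = f(|x|) A x + (1 - f(|x|)) J x`. -/
def radialInterpolation (A J : Module.End ℝ V) (f : ℝ → ℝ) (x : V) : V :=
  f ‖x‖ • A x + (1 - f ‖x‖) • J x

theorem contDiff_radialInterpolation (A J : Module.End ℝ V) {ε : ℝ} {f : ℝ → ℝ}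
    (hf : IsSlowBump ε f) : ContDiff ℝ ∞ (radialInterpolation A J f) := by
  have hn : ContDiff ℝ ∞ fun x : V => f ‖x‖ := by
    refine contDiff_iff_contDiffAt.2 fun x => ?_
    by_cases hx : x = 0
    · subst hx
      refine (contDiffAt_const (c := (1 : ℝ))).congr_of_eventuallyEq ?_
      have := (continuous_norm (E := V)).tendsto 0
      rw [norm_zero] at this
      exact this.eventually hf.eq_one
    · exact hf.contDiff.contDiffAt.comp x (contDiffAt_norm ℝ hx)
  exact (hn.smul (LinearMap.toContinuousLinearMap A).contDiff).add
    ((contDiff_const.sub hn).smul (LinearMap.toContinuousLinearMap J).contDiff)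

/-- By homogeneity in `(a, b)` and in `x` it suffices to bound the norm on a product of unit spheres
with `[0, 1]`. This is compact, and the norm does not vanish there by
`IsAssociatedComplexStructure.eq_zero_of_combination`. -/
theorem exists_lower_bound {A J : Module.End ℝ V} (hAJ : IsAssociatedComplexStructure A J)
    (hA : HasNoRealEigenvalues A) (hc : Commute A J) :
    ∃ c : ℝ, 0 < c ∧ ∀ t ∈ Icc (0 : ℝ) 1, ∀ (a b : ℝ) (x : V),
      c * ‖(a, b)‖ * ‖x‖ ≤ ‖a • x + b • (t • A x + (1 - t) • J x)‖ := by
  let K : Set ((ℝ × ℝ) × ℝ × V) := sphere 0 1 ×ˢ Icc 0 1 ×ˢ sphere 0 1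
  have hK : IsCompact K := (isCompact_sphere _ _).prod (isCompact_Icc.prod (isCompact_sphere _ _))
  let F : (ℝ × ℝ) × ℝ × V → V := fun p =>
    p.1.1 • p.2.2 + p.1.2 • (p.2.1 • A p.2.2 + (1 - p.2.1) • J p.2.2)
  have hAc : Continuous A := A.continuous_of_finiteDimensional
  have hJc : Continuous J := J.continuous_of_finiteDimensional
  have hF : Continuous F := by fun_prop
  obtain ⟨c, hc0, hcK⟩ := hK.exists_forall_le' hF.norm.continuousOn (a := 0) (by
    rintro ⟨⟨a, b⟩, t, x⟩ ⟨hab, ht, hx⟩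
    refine norm_pos_iff.2 fun h0 => ?_
    have hx0 : x ≠ 0 := by
      rintro rfl; simp at hx
    have hab0 : (a, b) ≠ (0 : ℝ × ℝ) := by
      intro h
      simp only at hab
      rw [h] at hab; simp at hab
    refine hx0 (hAJ.eq_zero_of_combination hA hc ht ?_ h0)
    by_contra! h
    exact hab0 (Prod.ext h.1 h.2))
  refine ⟨c, hc0, fun t ht a b x => ?_⟩
  by_cases hx : x = 0
  · simp [hx]
  by_cases hab : (a, b) = (0 : ℝ × ℝ)
  · rw [hab, norm_zero, mul_zero, zero_mul]; positivity
  have hx' : 0 < ‖x‖ := norm_pos_iff.2 hx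
  have hab' : 0 < ‖(a, b)‖ := norm_pos_iff.2 hab
  have h1 := hcK (‖(a, b)‖⁻¹ • (a, b), t, ‖x‖⁻¹ • x)
    ⟨by simp only [mem_sphere_zero_iff_norm]; rw [norm_smul, norm_inv, norm_norm,
        inv_mul_cancel₀ hab'.ne'], ht,
      by simp only [mem_sphere_zero_iff_norm]; rw [norm_smul, norm_inv, norm_norm,
        inv_mul_cancel₀ hx'.ne']⟩
  have h2 : F (‖(a, b)‖⁻¹ • (a, b), t, ‖x‖⁻¹ • x) =
      (‖(a, b)‖ * ‖x‖)⁻¹ • (a • x + b • (t • A x + (1 - t) • J x)) := by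
    simp only [F, Prod.smul_mk, map_smul, smul_eq_mul, mul_inv]
    module
  rw [h2, norm_smul, norm_inv, Real.norm_of_nonneg (by positivity), ← div_eq_inv_mul,
    le_div_iff₀ (by positivity)] at h1
  linarith

/-- The difference is the linear combination with `t = f ‖x'‖` frozen, applied to `x - x'`, minus an
error `b (f ‖x'‖ - f ‖x‖) (A x - J x)`. With `D` bounding `A - J`, the choice `ε = c / (2 D)` keeps
the error below half of the main term. -/
theorem exists_slow_lower_bound {A J : Module.End ℝ V} (hAJ : IsAssociatedComplexStructure A J)
    (hA : HasNoRealEigenvalues A) (hc : Commute A J) :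
    ∃ ε k : ℝ, 0 < ε ∧ 0 < k ∧ ∀ f, IsSlowBump ε f → ∀ (a b : ℝ) (x x' : V),
      k * ‖(a, b)‖ * ‖x - x'‖ ≤ ‖(a • x + b • radialInterpolation A J f x) -
        (a • x' + b • radialInterpolation A J f x')‖ := by
  obtain ⟨c, hc0, hcb⟩ := exists_lower_bound hAJ hA hc
  let D : ℝ := ‖LinearMap.toContinuousLinearMap (A - J)‖ + 1
  have hD0 : 0 < D := by positivity
  have hD : ∀ x, ‖A x - J x‖ ≤ D * ‖x‖ := fun x => by
    have := (LinearMap.toContinuousLinearMap (A - J)).le_opNorm x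
    simp only [LinearMap.coe_toContinuousLinearMap', LinearMap.sub_apply] at this
    refine this.trans (mul_le_mul_of_nonneg_right (by simp [D]) (norm_nonneg x))
  refine ⟨c / (2 * D), c / 2, by positivity, by positivity, fun f hf a b => ?_⟩
  -- The error must be carried by the vector of smaller norm, as `IsSlowBump.abs_sub_mul_le`
  -- demands; the claim is symmetric in `x` and `x'`.
  have key : ∀ x x' : V, ‖x‖ ≤ ‖x'‖ →
      c / 2 * ‖(a, b)‖ * ‖x - x'‖ ≤ ‖(a • x + b • radialInterpolation A J f x) -
        (a • x' + b • radialInterpolation A J f x')‖ := by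
    intro x x' hxx
    have e : (a • x + b • radialInterpolation A J f x) -
        (a • x' + b • radialInterpolation A J f x') =
        (a • (x - x') + b • (f ‖x'‖ • A (x - x') + (1 - f ‖x'‖) • J (x - x'))) -
          (b * (f ‖x'‖ - f ‖x‖)) • (A x - J x) := by
      simp only [radialInterpolation, map_sub]
      module
    have h1 := hcb _ (hf.mem_Icc ‖x'‖) a b (x - x')
    have h2 : ‖(b * (f ‖x'‖ - f ‖x‖)) • (A x - J x)‖ ≤ c / 2 * ‖(a, b)‖ * ‖x - x'‖ := by
      rw [norm_smul, norm_mul, Real.norm_eq_abs (f ‖x'‖ - f ‖x‖)]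
      have hb : ‖b‖ ≤ ‖(a, b)‖ := norm_snd_le (a, b)
      have h3 := hf.abs_sub_mul_le (norm_nonneg x) hxx
      have h4 : ‖x'‖ - ‖x‖ ≤ ‖x - x'‖ := by
        rw [norm_sub_rev]; exact norm_sub_norm_le _ _
      calc ‖b‖ * |f ‖x'‖ - f ‖x‖| * ‖A x - J x‖
          ≤ ‖b‖ * |f ‖x'‖ - f ‖x‖| * (D * ‖x‖) := by gcongr; exact hD x
        _ = ‖b‖ * (D * (|f ‖x'‖ - f ‖x‖| * ‖x‖)) := by ring
        _ ≤ ‖(a, b)‖ * (D * (c / (2 * D) * ‖x - x'‖)) := by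
            have h6 := h3.trans (mul_le_mul_of_nonneg_left h4 (by positivity))
            gcongr ?_ * (D * ?_)
        _ = c / 2 * ‖(a, b)‖ * ‖x - x'‖ := by field_simp
    rw [e]
    have h5 := norm_sub_norm_le
      (a • (x - x') + b • (f ‖x'‖ • A (x - x') + (1 - f ‖x'‖) • J (x - x')))
      ((b * (f ‖x'‖ - f ‖x‖)) • (A x - J x))
    linarith
  intro x x'
  rcases le_total ‖x‖ ‖x'‖ with h | h
  · exact key x x' h
  · rw [norm_sub_rev, norm_sub_rev (_ + _)]
    exact key x' x h

/-- The image is open because the derivatives are injective, hence invertible, and closed because an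
expanding continuous map is proper. As `V` is connected, the image is all of `V`. -/
theorem bijective_of_lower_bound {G : V → V} (hG : ContDiff ℝ ∞ G) {k : ℝ} (hk0 : 0 < k)
    (hk : ∀ x y, k * ‖x - y‖ ≤ ‖G x - G y‖) : Function.Bijective G := by
  have hanti : AntilipschitzWith (⟨k⁻¹, by positivity⟩ : NNReal) G :=
    AntilipschitzWith.of_le_mul_dist fun x y => by
      have := hk x y
      rw [dist_eq_norm, dist_eq_norm]
      change _ ≤ k⁻¹ * _
      rw [← div_eq_inv_mul, le_div_iff₀ hk0]
      linarith
  refine ⟨hanti.injective, ?_⟩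
  have hder : ∀ x, HasStrictFDerivAt G (fderiv ℝ G x) x := fun x =>
    hG.contDiffAt.hasStrictFDerivAt (by simp)
  have hinj : ∀ x, Function.Injective (fderiv ℝ G x : V →ₗ[ℝ] V) := fun x => by
    rw [injective_iff_map_eq_zero]
    intro v hv
    have := (hder x).hasFDerivAt.le_norm_apply (fun y => hk y x) v
    have hv' : fderiv ℝ G x v = 0 := hv
    rw [hv', norm_zero] at this
    exact norm_le_zero_iff.1 (by nlinarith [norm_nonneg v])
  have hopen : IsOpenMap G := isOpenMap_of_hasStrictFDerivAt_equiv
    (f' := fun x => (LinearEquiv.ofInjectiveEndo _ (hinj x)).toContinuousLinearEquiv) fun x => by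
      convert hder x using 1
      exact ContinuousLinearMap.ext fun _ => rfl
  have hclosed : IsClosedMap G := by
    refine IsProperMap.isClosedMap (isProperMap_iff_tendsto_cocompact.2 ⟨hG.continuous, ?_⟩)
    simpa [Metric.cobounded_eq_cocompact] using hanti.tendsto_cobounded
  rw [← range_eq_univ]
  exact IsClopen.eq_univ ⟨hclosed.isClosed_range, hopen.isOpen_range⟩ (range_nonempty G)

/-- For `N` the interpolation, `g (θ, y)` is the value at `e 0` of the plane of the family through
the vector with `P`-coordinates `θ` and `Pᗮ`-component `y`. -/
theorem exists_contDiffAt_inverse {N : V → V} (hN : ContDiff ℝ ∞ N) {k : ℝ} (hk0 : 0 < k)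
    (hk : ∀ (a b : ℝ) (x x' : V),
      k * ‖(a, b)‖ * ‖x - x'‖ ≤ ‖(a • x + b • N x) - (a • x' + b • N x')‖) :
    ∃ g : (ℝ × ℝ) × V → V, ∀ θ : ℝ × ℝ, θ ≠ 0 → ∀ y : V,
      (∀ x, θ.1 • x + θ.2 • N x = y ↔ x = g (θ, y)) ∧ ContDiffAt ℝ ∞ g (θ, y) := by
  have hG : ∀ θ : ℝ × ℝ, ContDiff ℝ ∞ fun x => θ.1 • x + θ.2 • N x := fun θ =>
    (contDiff_const.smul contDiff_id).add (contDiff_const.smul hN)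
  have hbij : ∀ θ : ℝ × ℝ, θ ≠ 0 → Function.Bijective fun x => θ.1 • x + θ.2 • N x := fun θ hθ =>
    bijective_of_lower_bound (hG θ) (mul_pos hk0 (norm_pos_iff.2 hθ)) (hk θ.1 θ.2)
  choose! g hg using fun θ hθ => (hbij θ hθ).2
  refine ⟨fun p => g p.1 p.2, fun θ hθ y => ⟨fun x => ⟨fun h => (hbij θ hθ).1 ?_, ?_⟩, ?_⟩⟩
  · exact h.trans (hg θ hθ y).symm
  · rintro rfl
    exact hg θ hθ y
  · set x := g θ y with hx
    have hxy : θ.1 • x + θ.2 • N x = y := hg θ hθ y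
    -- Keeping `θ` as a component lets one inverse function theorem give smoothness jointly in `θ`
    -- and `y`. Fibrewise injectivity then identifies the local inverse with `g`.
    let Φ : (ℝ × ℝ) × V → (ℝ × ℝ) × V := fun p => (p.1, p.1.1 • p.2 + p.1.2 • N p.2)
    have hΦ : ContDiff ℝ ∞ Φ := by
      refine contDiff_fst.prodMk (ContDiff.add ?_ ?_)
      · exact contDiff_fst.fst.smul contDiff_snd
      · exact contDiff_fst.snd.smul (hN.comp contDiff_snd)
    have hder : HasFDerivAt Φ (fderiv ℝ Φ (θ, x)) (θ, x) :=
      (hΦ.differentiable (by simp) _).hasFDerivAt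
    have hinj : Function.Injective (fderiv ℝ Φ (θ, x) : (ℝ × ℝ) × V →ₗ[ℝ] (ℝ × ℝ) × V) := by
      rw [injective_iff_map_eq_zero]
      rintro ⟨τ, v⟩ h
      have h : fderiv ℝ Φ (θ, x) (τ, v) = 0 := h
      have h1 : HasFDerivAt (fun p : (ℝ × ℝ) × V => p.1)
        ((ContinuousLinearMap.fst ℝ _ _).comp (fderiv ℝ Φ (θ, x))) (θ, x) := hder.fst
      have h2 := DFunLike.congr_fun (h1.unique hasFDerivAt_fst) (τ, v)
      obtain rfl : τ = 0 := by
        simpa [h] using h2.symm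
      have h3 : HasFDerivAt (fun v : V => (θ, v)) (ContinuousLinearMap.inr ℝ (ℝ × ℝ) V) x :=
        hasFDerivAt_prodMk_right θ x
      have h4 : HasFDerivAt (fun x => θ.1 • x + θ.2 • N x)
        ((ContinuousLinearMap.snd ℝ (ℝ × ℝ) V).comp ((fderiv ℝ Φ (θ, x)).comp
          (ContinuousLinearMap.inr ℝ (ℝ × ℝ) V))) x := (hder.comp x h3).snd
      have h5 := h4.le_norm_apply (fun z => hk θ.1 θ.2 z x) v
      have h6 : ‖v‖ ≤ 0 := by
        have h7 : 0 < k * ‖θ‖ := mul_pos hk0 (norm_pos_iff.2 hθ)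
        simp only [ContinuousLinearMap.comp_apply, ContinuousLinearMap.inr_apply, h] at h5
        simp only [map_zero, norm_zero] at h5
        by_contra! h8
        exact absurd (mul_pos h7 h8) (not_lt.2 h5)
      rw [norm_le_zero_iff.1 h6]
      rfl
    let Φ' := (LinearEquiv.ofInjectiveEndo _ hinj).toContinuousLinearEquiv
    have hder' : HasFDerivAt Φ (Φ' : (ℝ × ℝ) × V →L[ℝ] (ℝ × ℝ) × V) (θ, x) := by
      convert hder using 1
      exact ContinuousLinearMap.ext fun _ => rfl
    have hat : ContDiffAt ℝ ∞ Φ (θ, x) := hΦ.contDiffAt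
    have hinv := hat.to_localInverse hder' (by simp)
    have hΦx : Φ (θ, x) = (θ, y) := Prod.ext rfl hxy
    have hstrict := hat.hasStrictFDerivAt' hder' (by simp)
    have hr := hstrict.eventually_right_inverse
    rw [hΦx] at hinv hr
    refine hinv.snd.congr_of_eventuallyEq ?_
    have hne : ∀ᶠ p : (ℝ × ℝ) × V in 𝓝 (θ, y), p.1 ≠ 0 :=
      continuous_fst.continuousAt.eventually_ne hθ
    filter_upwards [hr, hne] with p hp hp0
    have e1 := congrArg Prod.fst hp
    have e2 := congrArg Prod.snd hp
    simp only [Φ] at e1 e2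
    rw [e1] at e2
    exact (hbij p.1 hp0).1 ((hg p.1 hp0 p.2).trans e2.symm)

end Interpolation

/-! ### Smooth maps into spheres by radial projection. -/

section SphereProj

variable {E : Type*} [NormedAddCommGroup E] [InnerProductSpace ℝ E]

/-- The radial projection of `E \ {0}` to the unit sphere. -/
noncomputable def sphereProj (p : sphere (0 : E) 1) (y : E) : sphere (0 : E) 1 :=
  open Classical in
  if h : y = 0 then p else ⟨‖y‖⁻¹ • y, by
    rw [mem_sphere_zero_iff_norm, norm_smul, norm_inv, norm_norm,
      inv_mul_cancel₀ (norm_ne_zero_iff.2 h)]⟩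

theorem coe_sphereProj (p : sphere (0 : E) 1) {y : E} (h : y ≠ 0) :
    (sphereProj p y : E) = ‖y‖⁻¹ • y := by
  rw [sphereProj, dif_neg h]

theorem sphereProj_smul (p : sphere (0 : E) 1) (y : sphere (0 : E) 1) {c : ℝ} (hc : 0 < c) :
    sphereProj p (c • (y : E)) = y := by
  have hy : ‖(y : E)‖ = 1 := by simp
  have hy0 : (y : E) ≠ 0 := by rw [← norm_ne_zero_iff, hy]; exact one_ne_zero
  apply Subtype.ext
  rw [coe_sphereProj p (smul_ne_zero hc.ne' hy0), norm_smul, hy, mul_one, Real.norm_of_nonneg hc.le,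
    smul_smul, inv_mul_cancel₀ hc.ne', one_smul]

variable {F : Type*} [NormedAddCommGroup F] [NormedSpace ℝ F] {H : Type*} [TopologicalSpace H]
  {I : ModelWithCorners ℝ F H} {M : Type*} [TopologicalSpace M] [ChartedSpace H M]

/-- The chart of the sphere at `f x` is stereographic projection from `-(f x)`, whose formula is
smooth on an open subset of `E` containing `f x`. -/
theorem ContMDiffAt.of_coe_sphere {n : ℕ} [Fact (Module.finrank ℝ E = n + 1)]
    {f : M → sphere (0 : E) 1} {x : M} (hf : ContMDiffAt I 𝓘(ℝ, E) ∞ (fun y => (f y : E)) x) :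
    ContMDiffAt I (𝓡 n) ∞ f x := by
  rw [contMDiffAt_iff_target]
  refine ⟨Topology.IsInducing.subtypeVal.continuousAt_iff.2 hf.continuousAt, ?_⟩
  let U : _ ≃ₗᵢ[ℝ] _ :=
    (OrthonormalBasis.fromOrthogonalSpanSingleton
      n (ne_zero_of_mem_unit_sphere (-(f x)))).repr
  have hopen : IsOpen {y : E | innerSL ℝ (-(f x) : E) y ≠ 1} :=
    isOpen_ne_fun (ContinuousLinearMap.continuous _) continuous_const
  have hmem : (f x : E) ∈ {y : E | innerSL ℝ (-(f x) : E) y ≠ 1} := by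
    simp only [mem_ofPred_eq, innerSL_apply_apply, inner_neg_left, real_inner_self_eq_norm_sq]
    rw [norm_eq_of_mem_sphere]
    norm_num
  have h1 : ContDiffAt ℝ ∞ (fun y => U (stereoToFun (-(f x) : E) y)) (f x) :=
    U.contDiff.contDiffAt.comp _ ((contDiffOn_stereoToFun (n := ∞)).contDiffAt (hopen.mem_nhds hmem))
  have h2 := h1.contMDiffAt.comp x hf
  convert! h2 using 1

theorem contMDiffAt_sphereProj {n : ℕ} [Fact (Module.finrank ℝ E = n + 1)]
    (p : sphere (0 : E) 1) {f : M → E} {x : M} (hf : ContMDiffAt I 𝓘(ℝ, E) ∞ f x)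
    (h0 : f x ≠ 0) : ContMDiffAt I (𝓡 n) ∞ (fun y => sphereProj p (f y)) x := by
  refine ContMDiffAt.of_coe_sphere ?_
  have h1 : ContDiffAt ℝ ∞ (fun y : E => ‖y‖⁻¹ • y) (f x) :=
    ((contDiffAt_norm ℝ h0).inv (norm_ne_zero_iff.2 h0)).smul contDiffAt_id
  refine (h1.contMDiffAt.comp x hf).congr_of_eventuallyEq ?_
  filter_upwards [hf.continuousAt.eventually_ne h0] with y hy
  exact coe_sphereProj p hy

theorem contMDiffAt_circleProj (p : sphere (0 : EuclideanSpace ℝ (Fin 2)) 1)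
    {f : M → EuclideanSpace ℝ (Fin 2)} {x : M}
    (hf : ContMDiffAt I 𝓘(ℝ, EuclideanSpace ℝ (Fin 2)) ∞ f x) (h0 : f x ≠ 0) :
    ContMDiffAt I (𝓡 1) ∞ (fun y => sphereProj p (f y)) x :=
  have : Fact (Module.finrank ℝ (EuclideanSpace ℝ (Fin 2)) = 1 + 1) :=
    ⟨finrank_euclideanSpace_fin⟩
  contMDiffAt_sphereProj p hf h0

theorem contMDiff_coe_circle : ContMDiff (𝓡 1) 𝓘(ℝ, EuclideanSpace ℝ (Fin 2)) ∞
    ((↑) : sphere (0 : EuclideanSpace ℝ (Fin 2)) 1 → EuclideanSpace ℝ (Fin 2)) :=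
  have : Fact (Module.finrank ℝ (EuclideanSpace ℝ (Fin 2)) = 1 + 1) :=
    ⟨finrank_euclideanSpace_fin⟩
  contMDiff_coe_sphere

end SphereProj

/-! ### Local trivializations from smooth frames. -/

section FibreChart

variable {E : Type*} [NormedAddCommGroup E] [InnerProductSpace ℝ E]

/-- The family `π` of great circles is near `v` smoothly trivial. -/
def IsLocallyTrivialAt (n : ℕ) [Fact (Module.finrank ℝ E = 2 * n + 1 + 1)]
    (π : sphere (0 : E) 1 → OrientedPlane E) (v : sphere (0 : E) 1) : Prop :=
  ∃ φ : OpenPartialHomeomorph (sphere (0 : E) 1)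
      (EuclideanSpace ℝ (Fin (2 * n)) × sphere (0 : EuclideanSpace ℝ (Fin 2)) 1),
    v ∈ φ.source ∧
    (∃ D : Set (EuclideanSpace ℝ (Fin (2 * n))), φ.target = D ×ˢ univ) ∧
    ContMDiffOn (𝓡 (2 * n + 1)) ((𝓡 (2 * n)).prod (𝓡 1)) ∞ φ φ.source ∧
    ContMDiffOn ((𝓡 (2 * n)).prod (𝓡 1)) (𝓡 (2 * n + 1)) ∞ φ.symm φ.target ∧
    ∀ u ∈ φ.source, ∀ w, π w = π u ↔ (w ∈ φ.source ∧ (φ w).1 = (φ u).1)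

/-- Local triviality of a family of great circles which has a smooth frame, parametrized by an
open subset `D` of `ℝ^(2n)`. -/
theorem exists_fibre_chart {n : ℕ} [Fact (Module.finrank ℝ E = 2 * n + 1 + 1)]
    {π : sphere (0 : E) 1 → OrientedPlane E} (hself : ∀ u, (u : E) ∈ (π u).plane)
    {s₀ s₁ : EuclideanSpace ℝ (Fin (2 * n)) → E} (hs₀ : ContDiff ℝ ∞ s₀) (hs₁ : ContDiff ℝ ∞ s₁)
    (hlin : ∀ x, ∀ a b : ℝ, a • s₀ x + b • s₁ x = 0 → a = 0 ∧ b = 0)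
    {D : Set (EuclideanSpace ℝ (Fin (2 * n)))} (hD : IsOpen D) {Ω : Set E} (hΩ : IsOpen Ω)
    {g : E → EuclideanSpace ℝ (Fin (2 * n))} {h : E → EuclideanSpace ℝ (Fin 2)}
    (hg : ∀ u ∈ Ω, ContDiffAt ℝ ∞ g u) (hh : ∀ u ∈ Ω, ContDiffAt ℝ ∞ h u)
    (hgD : ∀ u ∈ Ω, g u ∈ D) (hu : ∀ u ∈ Ω, u = h u 0 • s₀ (g u) + h u 1 • s₁ (g u))
    (hinv : ∀ d ∈ D, ∀ θ : EuclideanSpace ℝ (Fin 2), θ ≠ 0 →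
      θ 0 • s₀ d + θ 1 • s₁ d ∈ Ω ∧ g (θ 0 • s₀ d + θ 1 • s₁ d) = d ∧
        h (θ 0 • s₀ d + θ 1 • s₁ d) = θ)
    (hπ : ∀ u : sphere (0 : E) 1, (u : E) ∈ Ω → (π u).IsFrame (s₀ (g u)) (s₁ (g u)))
    {v : sphere (0 : E) 1} (hv : (v : E) ∈ Ω) :
    ContinuousAt π v ∧ IsLocallyTrivialAt n π v := by
  have hne : ∀ u : sphere (0 : E) 1, (u : E) ≠ 0 := fun u => ne_zero_of_mem_unit_sphere u
  have hh0 : ∀ u : sphere (0 : E) 1, (u : E) ∈ Ω → h u ≠ 0 := fun u hu' h0 => by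
    have := hu u hu'
    rw [h0] at this
    exact hne u (by simpa using this)
  have hsrc : IsOpen {u : sphere (0 : E) 1 | (u : E) ∈ Ω} := hΩ.preimage continuous_subtype_val
  constructor
  · refine OrientedPlane.continuousAt_of_isFrame (π := π) (u := fun u => s₀ (g u))
      (w := fun u => s₁ (g u)) ?_ ?_ ?_
    · exact hs₀.continuous.continuousAt.comp
        ((hg v hv).continuousAt.comp continuous_subtype_val.continuousAt)
    · exact hs₁.continuous.continuousAt.comp
        ((hg v hv).continuousAt.comp continuous_subtype_val.continuousAt)
    · filter_upwards [hsrc.mem_nhds hv] with u hu' using hπ u hu'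
  -- Only the default value of `sphereProj` at `0`; on the source of the chart `h` does not vanish.
  let p : sphere (0 : EuclideanSpace ℝ (Fin 2)) 1 := ⟨EuclideanSpace.single 0 1, by simp⟩
  let Ψ : EuclideanSpace ℝ (Fin (2 * n)) × EuclideanSpace ℝ (Fin 2) → E :=
    fun q => q.2 0 • s₀ q.1 + q.2 1 • s₁ q.1
  have hΨs : ContDiff ℝ ∞ Ψ := by
    refine ContDiff.add ?_ ?_
    · exact ((EuclideanSpace.proj (𝕜 := ℝ) (0 : Fin 2)).contDiff.comp contDiff_snd).smul
        (hs₀.comp contDiff_fst)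
    · exact ((EuclideanSpace.proj (𝕜 := ℝ) (1 : Fin 2)).contDiff.comp contDiff_snd).smul
        (hs₁.comp contDiff_fst)
  have hΨ0 : ∀ d (θ : sphere (0 : EuclideanSpace ℝ (Fin 2)) 1), Ψ (d, θ) ≠ 0 := fun d θ h0 => by
    obtain ⟨e0, e1⟩ := hlin d _ _ h0
    refine ne_zero_of_mem_unit_sphere θ ?_
    ext i
    fin_cases i
    · exact e0
    · exact e1
  have hΨsmul : ∀ d θ (c : ℝ), c • Ψ (d, θ) = Ψ (d, c • θ) := fun d θ c => by
    simp only [Ψ, smul_add, smul_smul, PiLp.smul_apply, smul_eq_mul]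
  -- The frame need not be orthonormal, so both directions of the chart normalize. Normalizing `Ψ
  -- (d, θ)` only rescales `θ` by a positive factor, which the projection to the circle undoes.
  have hproj : ∀ d (θ : sphere (0 : EuclideanSpace ℝ (Fin 2)) 1),
      ∃ c : ℝ, 0 < c ∧ (sphereProj v (Ψ (d, θ)) : E) = Ψ (d, c • θ) := fun d θ => by
    refine ⟨‖Ψ (d, θ)‖⁻¹, inv_pos.2 (norm_pos_iff.2 (hΨ0 d θ)), ?_⟩
    rw [coe_sphereProj v (hΨ0 d θ), hΨsmul]
  have hcθ : ∀ (θ : sphere (0 : EuclideanSpace ℝ (Fin 2)) 1) (c : ℝ), 0 < c →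
      c • (θ : EuclideanSpace ℝ (Fin 2)) ≠ 0 := fun θ c hc =>
    smul_ne_zero hc.ne' (ne_zero_of_mem_unit_sphere θ)
  have hto : ∀ u : sphere (0 : E) 1, (u : E) ∈ Ω →
      ContMDiffAt (𝓡 (2 * n + 1)) ((𝓡 (2 * n)).prod (𝓡 1)) ∞
        (fun u : sphere (0 : E) 1 => (g u, sphereProj p (h u))) u := fun u hu' => by
    refine ContMDiffAt.prodMk ?_ (contMDiffAt_circleProj p ?_ (hh0 u hu'))
    · exact (hg u hu').contMDiffAt.comp u contMDiff_coe_sphere.contMDiffAt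
    · exact (hh u hu').contMDiffAt.comp u contMDiff_coe_sphere.contMDiffAt
  have hfrom : ContMDiff ((𝓡 (2 * n)).prod (𝓡 1)) (𝓡 (2 * n + 1)) ∞
      (fun q : EuclideanSpace ℝ (Fin (2 * n)) × sphere (0 : EuclideanSpace ℝ (Fin 2)) 1 =>
        sphereProj v (Ψ (q.1, q.2))) := fun q => by
    refine contMDiffAt_sphereProj v ?_ (hΨ0 _ _)
    refine hΨs.contDiffAt.contMDiffAt.comp q ?_
    exact contMDiffAt_fst.prodMk_space (contMDiff_coe_circle.contMDiffAt.comp q contMDiffAt_snd)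
  let φ : OpenPartialHomeomorph (sphere (0 : E) 1)
      (EuclideanSpace ℝ (Fin (2 * n)) × sphere (0 : EuclideanSpace ℝ (Fin 2)) 1) :=
    { toFun := fun u => (g u, sphereProj p (h u))
      invFun := fun q => sphereProj v (Ψ (q.1, q.2))
      source := {u | (u : E) ∈ Ω}
      target := D ×ˢ univ
      map_source' := fun u hu' => ⟨hgD u hu', mem_univ _⟩
      map_target' := fun q hq => by
        obtain ⟨c, hc, hq'⟩ := hproj q.1 q.2
        rw [mem_ofPred_eq, hq']
        exact (hinv q.1 hq.1 _ (hcθ q.2 c hc)).1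
      left_inv' := fun u hu' => by
        simp only
        rw [coe_sphereProj p (hh0 u hu'), ← hΨsmul]
        have : Ψ (g u, h u) = u := (hu u hu').symm
        rw [this]
        exact sphereProj_smul v u (inv_pos.2 (norm_pos_iff.2 (hh0 u hu')))
      right_inv' := fun q hq => by
        obtain ⟨c, hc, hq'⟩ := hproj q.1 q.2
        obtain ⟨-, h1, h2⟩ := hinv q.1 hq.1 _ (hcθ q.2 c hc)
        simp only [hq']
        refine Prod.ext h1 ?_
        have h2 : h (Ψ (q.1, c • q.2)) = c • (q.2 : EuclideanSpace ℝ (Fin 2)) := h2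
        simp only [h2]
        exact sphereProj_smul p q.2 hc
      open_source := hsrc
      open_target := hD.prod isOpen_univ
      continuousOn_toFun := fun u hu' => (hto u hu').continuousAt.continuousWithinAt
      continuousOn_invFun := hfrom.continuous.continuousOn }
  refine ⟨φ, hv, ⟨D, rfl⟩, fun u hu' => (hto u hu').contMDiffWithinAt, hfrom.contMDiffOn, ?_⟩
  intro u hu' w
  constructor
  · intro hwu
    obtain ⟨a, b, hab⟩ := (hπ u hu').mem_iff.1 (hwu ▸ hself w)
    have hθ : (!₂[a, b] : EuclideanSpace ℝ (Fin 2)) ≠ 0 := fun h0 => by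
      have e0 : a = 0 := by simpa using congrArg (fun x => x 0) h0
      have e1 : b = 0 := by simpa using congrArg (fun x => x 1) h0
      exact hne w (by rw [hab, e0, e1, zero_smul, zero_smul, add_zero])
    obtain ⟨h1, h2, -⟩ := hinv (g u) (hgD u hu') _ hθ
    have e : (!₂[a, b] : EuclideanSpace ℝ (Fin 2)) 0 • s₀ (g u) +
        (!₂[a, b] : EuclideanSpace ℝ (Fin 2)) 1 • s₁ (g u) = w := by
      rw [hab]; simp
    rw [e] at h1 h2
    exact ⟨h1, h2⟩
  · rintro ⟨hw, hwu⟩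
    have hw2 := hπ w hw
    have hwu : g w = g u := hwu
    rw [hwu] at hw2
    exact hw2.unique (hπ u hu')

end FibreChart

/-! ### Graphs as submanifolds, and the submanifold of complex lines. -/

/-- The shear `L ↦ L - σ (G (ev L))` straightens `ev' L = G (ev L)` to `ker ev'`. It does not change
`ev L`, so the shear with opposite sign is its inverse. -/
theorem isSmoothSubmanifoldNear_of_section {T Y : Type*} [NormedAddCommGroup T] [NormedSpace ℝ T]
    [NormedAddCommGroup Y] [NormedSpace ℝ Y] (ev ev' : T →L[ℝ] Y) (σ : Y →L[ℝ] T)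
    (hσ : ∀ y, ev (σ y) = 0) (hσ' : ∀ y, ev' (σ y) = y) {O : Set Y} (hO : IsOpen O) {G : Y → Y}
    (hG : ContDiffOn ℝ ∞ G O) {S U : Set T} (hU : IsOpen U) {L₀ : T} (hL₀ : L₀ ∈ U)
    (hL₀O : ev L₀ ∈ O) (hS : ∀ L ∈ U, ev L ∈ O → (L ∈ S ↔ ev' L = G (ev L))) :
    IsSmoothSubmanifoldNear (Module.finrank ℝ (LinearMap.ker ev'.toLinearMap)) S L₀ := by
  have hsm : ContDiffOn ℝ ∞ (fun L : T => σ (G (ev L))) (ev ⁻¹' O) :=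
    σ.contDiff.comp_contDiffOn (hG.comp ev.contDiff.contDiffOn fun L hL => hL)
  have hsub : ContDiffOn ℝ ∞ (fun L : T => L - σ (G (ev L))) (ev ⁻¹' O) :=
    contDiffOn_id.sub hsm
  have hadd : ContDiffOn ℝ ∞ (fun L : T => L + σ (G (ev L))) (ev ⁻¹' O) :=
    contDiffOn_id.add hsm
  have evsub : ∀ L : T, ev (L - σ (G (ev L))) = ev L := fun L => by rw [map_sub, hσ, sub_zero]
  have evadd : ∀ L : T, ev (L + σ (G (ev L))) = ev L := fun L => by rw [map_add, hσ, add_zero]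
  let φ : OpenPartialHomeomorph T T :=
    { toFun := fun L => L - σ (G (ev L))
      invFun := fun L => L + σ (G (ev L))
      source := ev ⁻¹' O
      target := ev ⁻¹' O
      map_source' := fun L hL => by rw [mem_preimage, evsub]; exact hL
      map_target' := fun L hL => by rw [mem_preimage, evadd]; exact hL
      left_inv' := fun L _ => by rw [evsub, sub_add_cancel]
      right_inv' := fun L _ => by rw [evadd, add_sub_cancel_right]
      open_source := hO.preimage ev.continuous
      open_target := hO.preimage ev.continuous
      continuousOn_toFun := hsub.continuousOn
      continuousOn_invFun := hadd.continuousOn }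
  refine ⟨φ.restrOpen U hU, LinearMap.ker ev'.toLinearMap, ⟨hL₀O, hL₀⟩,
    hsub.mono inter_subset_left, hadd.mono inter_subset_left, rfl, ?_⟩
  rintro L ⟨hL, hLU⟩
  rw [hS L hLU hL]
  change _ ↔ ev' (L - σ (G (ev L))) = 0
  rw [map_sub, hσ', sub_eq_zero]

namespace OrientedPlane

variable {E : Type*} [NormedAddCommGroup E] [InnerProductSpace ℝ E]

theorem linearIndependent_complex {J : Module.End ℝ E} (hJ : ∀ x, J (J x) = -x) {v : E}
    (hv : v ≠ 0) {s t : ℝ} (h : s • v + t • J v = 0) : s = 0 ∧ t = 0 := by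
  by_cases ht : t = 0
  · subst ht
    simpa [hv] using h
  · refine absurd (eq_zero_of_complexStructure_eq_smul hJ (x := v) (c := -s / t) ?_) hv
    have h1 : t • J v = t • ((-s / t) • v) := by
      rw [smul_smul, mul_div_cancel₀ _ ht, neg_smul]
      exact eq_neg_of_add_eq_zero_right h
    exact smul_right_injective E ht h1

theorem isFrame_of_mem_complexLines {J : Module.End ℝ E} {Q : OrientedPlane E}
    (hQ : Q ∈ complexLines J) {v : E} (hv : v ∈ Q.plane) (h0 : v ≠ 0) : Q.IsFrame v (J v) := by
  obtain ⟨b, h1, h2, h3⟩ := hQ ⟨v, hv⟩ (fun h => h0 (congrArg Subtype.val h))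
  exact ⟨b, congrArg Subtype.val h1, h2, h3⟩

theorem mem_complexLines_of_isFrame {J : Module.End ℝ E} (hJ : ∀ x, J (J x) = -x)
    {Q : OrientedPlane E} {v : E} (hQ : Q.IsFrame v (J v)) : Q ∈ complexLines J := by
  -- For `w = a v + b J v`, passing from `(v, J v)` to `(w, J w)` has determinant `a² + b²`, so the
  -- orientation is preserved.
  rintro ⟨w, hw⟩ hw0
  obtain ⟨a, b, rfl⟩ := hQ.mem_iff.1 hw
  have hpos : 0 < a * a - b * (-b) := by
    have : ¬ (a = 0 ∧ b = 0) := by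
      rintro ⟨rfl, rfl⟩
      exact hw0 (Subtype.ext (by simp))
    by_contra! h
    exact this ⟨by nlinarith [mul_self_nonneg a, mul_self_nonneg b],
      by nlinarith [mul_self_nonneg a, mul_self_nonneg b]⟩
  obtain ⟨β, h1, h2, h3⟩ := hQ.change hpos
  refine ⟨β, Subtype.ext h1, ?_, h3⟩
  rw [h2, map_add, map_smul, map_smul, hJ]
  module

theorem exists_complexLine {J : Module.End ℝ E} (hJ : ∀ x, J (J x) = -x) {v : E} (hv : v ≠ 0) :
    ∃ Q ∈ complexLines J, v ∈ Q.plane := by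
  obtain ⟨Q, hQ⟩ := exists_isFrame fun s t => linearIndependent_complex hJ hv (s := s) (t := t)
  exact ⟨Q, mem_complexLines_of_isFrame hJ hQ, hQ.left_mem⟩

theorem complexLine_unique {J : Module.End ℝ E} {v : E} (hv : v ≠ 0) {Q Q' : OrientedPlane E}
    (hQ : Q ∈ complexLines J) (hQ' : Q' ∈ complexLines J) (h : v ∈ Q.plane) (h' : v ∈ Q'.plane) :
    Q = Q' :=
  (isFrame_of_mem_complexLines hQ h hv).unique (isFrame_of_mem_complexLines hQ' h' hv)

/-- The coordinates with respect to a frame. -/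
theorem exists_coord {P : OrientedPlane E} {p q : P.plane} (h : P.IsFrame p q) :
    ∃ c d : P.plane →L[ℝ] ℝ, (∀ x, x = c x • p + d x • q) ∧
      c p = 1 ∧ c q = 0 ∧ d p = 0 ∧ d q = 1 := by
  obtain ⟨b, h0, h1, -⟩ := h
  obtain rfl := Subtype.ext h0
  obtain rfl := Subtype.ext h1
  refine ⟨LinearMap.toContinuousLinearMap (b.coord 0), LinearMap.toContinuousLinearMap (b.coord 1),
    fun v => ?_, by simp, by simp, by simp, by simp⟩
  rw [← Fin.sum_univ_two (fun i => LinearMap.toContinuousLinearMap (b.coord i) v • b i)]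
  exact (b.sum_repr v).symm

theorem finrank_ker_eval {P : OrientedPlane E} {p q : P.plane} (h : P.IsFrame p q) :
    Module.finrank ℝ (LinearMap.ker (ContinuousLinearMap.apply ℝ P.planeᗮ q).toLinearMap) =
      Module.finrank ℝ P.planeᗮ := by
  let ev : LinearMap.ker (ContinuousLinearMap.apply ℝ P.planeᗮ q).toLinearMap →ₗ[ℝ] P.planeᗮ :=
    (ContinuousLinearMap.apply ℝ P.planeᗮ p).toLinearMap ∘ₗ Submodule.subtype _
  refine (LinearEquiv.ofBijective ev ⟨?_, ?_⟩).finrank_eq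
  · rintro ⟨L, hL⟩ ⟨L', hL'⟩ hLL
    have h1 : L p = L' p := hLL
    have h2 : L q = 0 := hL
    have h3 : L' q = 0 := hL'
    exact Subtype.ext (tangent_ext h h1 (h2.trans h3.symm))
  · intro x
    obtain ⟨L, h1, h2⟩ := exists_tangent h x 0
    exact ⟨⟨L, h2⟩, h1⟩

/-- The graph of a smooth map between the two coordinates of `Hom(P, Pᗮ)` is a submanifold. -/
theorem isSmoothSubmanifoldNear_of_graph {P : OrientedPlane E} {p q : P.plane}
    (h : P.IsFrame p q) {O : Set P.planeᗮ} (hO : IsOpen O) {G : P.planeᗮ → P.planeᗮ}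
    (hG : ContDiffOn ℝ ∞ G O) {S U : Set P.Tangent} (hU : IsOpen U) {L₀ : P.Tangent}
    (hL₀ : L₀ ∈ U) (hL₀p : L₀ p ∈ O)
    (hS : ∀ L ∈ U, L p ∈ O → (L ∈ S ↔ L q = G (L p))) :
    IsSmoothSubmanifoldNear (Module.finrank ℝ P.planeᗮ) S L₀ := by
  obtain ⟨-, d, -, -, -, hdp, hdq⟩ := exists_coord h
  rw [← finrank_ker_eval h]
  exact isSmoothSubmanifoldNear_of_section (ContinuousLinearMap.apply ℝ P.planeᗮ p)
    (ContinuousLinearMap.apply ℝ P.planeᗮ q) (ContinuousLinearMap.smulRightL ℝ P.plane P.planeᗮ d)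
    (fun y => by simp [hdp]) (fun y => by simp [hdq]) hO hG hU hL₀ hL₀p hS

/-- Near a complex line `Q`, the set of complex lines is in the chart at `Q` the graph of
a smooth map. -/
theorem exists_slice_complexLines [FiniteDimensional ℝ E] {J : Module.End ℝ E}
    (hJ : ∀ x, J (J x) = -x) {Q : OrientedPlane E} (hQ : Q ∈ complexLines J) :
    ∃ p q : Q.plane, Q.IsFrame p q ∧ ∃ (O : Set Q.planeᗮ) (G : Q.planeᗮ → Q.planeᗮ), IsOpen O ∧
      0 ∈ O ∧ ContDiffOn ℝ ∞ G O ∧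
      ∀ L : Q.Tangent, L p ∈ O → (Q.graph L ∈ complexLines J ↔ L q = G (L p)) := by
  obtain ⟨p, _, hpp⟩ := Q.exists_frame
  have hp0 : (p : E) ≠ 0 := hpp.left_ne_zero
  have hF := isFrame_of_mem_complexLines hQ p.2 hp0
  let q : Q.plane := ⟨J p, hF.right_mem⟩
  have hF : Q.IsFrame p q := hF
  obtain ⟨c, d, hcd, -, -, -, -⟩ := exists_coord hF
  let Jc : E →L[ℝ] E := LinearMap.toContinuousLinearMap J
  let pr : E →L[ℝ] Q.plane := Q.plane.orthogonalProjectionOnto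
  let po : E →L[ℝ] Q.planeᗮ := Q.planeᗮ.orthogonalProjectionOnto
  let α : Q.planeᗮ →L[ℝ] ℝ := c ∘L pr ∘L Jc ∘L Q.planeᗮ.subtypeL
  let β : Q.planeᗮ →L[ℝ] ℝ := d ∘L pr ∘L Jc ∘L Q.planeᗮ.subtypeL
  let τ : Q.planeᗮ →L[ℝ] Q.planeᗮ := po ∘L Jc ∘L Q.planeᗮ.subtypeL
  -- With `q = J p`, the projection of `J (p + z)` to `Q` is `α z • p + (1 + β z) • q`. The graph of
  -- `L` with `L p = z` contains `J (p + z)` iff `α z • z + (1 + β z) • L q = τ z`, which is solved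
  -- for `L q`. Positivity of `1 + β z` also makes the orientations agree.
  refine ⟨p, q, hF, {z | 0 < 1 + β z}, fun z => (1 + β z)⁻¹ • (τ z - α z • z), ?_, ?_, ?_, ?_⟩
  · exact isOpen_lt continuous_const (continuous_const.add β.continuous)
  · simp
  · have hi : ContDiffOn ℝ ∞ (fun z => (1 + β z)⁻¹) {z | 0 < 1 + β z} :=
      (contDiff_const.add β.contDiff).contDiffOn.inv fun z hz => (show 0 < 1 + β z from hz).ne'
    have hτ : ContDiff ℝ ∞ fun z => τ z - α z • z := τ.contDiff.sub (α.contDiff.smul contDiff_id)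
    exact hi.smul hτ.contDiffOn
  · intro L hL
    have hL : 0 < 1 + β (L p) := hL
    have hu0 : ((p : E) + L p) ≠ 0 := (isFrame_graph hF L).left_ne_zero
    have hJu : J ((p : E) + L p) = q + J (L p) := map_add J _ _
    have h1 : pr (J ((p : E) + L p)) = α (L p) • p + (1 + β (L p)) • q := by
      have e1 : pr (q : E) = q := Submodule.orthogonalProjectionOnto_mem_subspace_eq_self q
      have e2 : pr (J (L p)) = α (L p) • p + β (L p) • q := hcd (pr (J (L p)))
      rw [hJu, map_add, e1, e2]
      module
    have h2 : po (J ((p : E) + L p)) = τ (L p) := by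
      have e1 : po (q : E) = 0 := Submodule.orthogonalProjectionOnto_orthogonal_apply_eq_zero q.2
      rw [hJu, map_add, e1, zero_add]
      rfl
    have h3 : L q = (1 + β (L p))⁻¹ • (τ (L p) - α (L p) • L p) ↔
        J ((p : E) + L p) ∈ (Q.graph L).plane := by
      rw [mem_graph_iff]
      change _ ↔ po _ = L (pr _)
      rw [h1, h2, map_add, map_smul, map_smul, eq_inv_smul_iff₀ hL.ne', eq_sub_iff_add_eq, add_comm,
        eq_comm]
    rw [h3]
    constructor
    · intro h
      exact (isFrame_of_mem_complexLines h (isFrame_graph hF L).left_mem hu0).right_mem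
    · intro h
      refine mem_complexLines_of_isFrame hJ (v := (p : E) + L p) ?_
      have hch := (isFrame_graph hF L).change (a := 1) (b := 0) (c := α (L p)) (d := 1 + β (L p))
        (by simpa using hL)
      have e3 : J ((p : E) + L p) = α (L p) • (p + L p : E) + (1 + β (L p)) • (q + L q : E) := by
        have e4 : po (J ((p : E) + L p)) = L (pr (J ((p : E) + L p))) := mem_graph_iff.1 h
        have e5 := Q.proj_sum (J ((p : E) + L p))
        change (pr _ : E) + (po _ : E) = _ at e5
        rw [e4, h1] at e5
        rw [← e5]
        simp only [map_add, map_smul]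
        push_cast
        module
      rw [← e3, one_smul, zero_smul, add_zero] at hch
      exact hch

end OrientedPlane

/-! ### The glued family covers every nonzero vector exactly once. -/

namespace OrientedPlane

variable {E : Type*} [NormedAddCommGroup E] [InnerProductSpace ℝ E]

/-- Coordinates `(a u, b u)` on `P` for the frame `(p, q)`, together with a complex structure
`K = (p ↦ q ↦ -p) ⊕ J` on `E = P ⊕ Pᗮ`. -/
structure IsAdapted (P : OrientedPlane E) (p q : P.plane) (a b : E →L[ℝ] ℝ)
    (J : Module.End ℝ P.planeᗮ) (K : Module.End ℝ E) : Prop where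
  frame : P.IsFrame p q
  proj : ∀ u, P.plane.orthogonalProjectionOnto u = a u • p + b u • q
  proj_map : ∀ u, P.plane.orthogonalProjectionOnto (K u) = (-b u) • p + a u • q
  orth_map : ∀ u, P.planeᗮ.orthogonalProjectionOnto (K u) = J (P.planeᗮ.orthogonalProjectionOnto u)
  apply_apply : ∀ x, J (J x) = -x

/-- The oriented planes which are in `N(P)` on the graph of `N`, and outside of `N(P)`
are complex lines of `K`. -/
def gluedBase (P : OrientedPlane E) (p q : P.plane) (N : P.planeᗮ → P.planeᗮ)
    (K : Module.End ℝ E) : Set (OrientedPlane E) :=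
  P.graph '' {L | L q = N (L p)} ∪ (complexLines K \ range P.graph)

theorem graph_mem_gluedBase {P : OrientedPlane E} {p q : P.plane} {N : P.planeᗮ → P.planeᗮ}
    {K : Module.End ℝ E} {L : P.Tangent} : P.graph L ∈ P.gluedBase p q N K ↔ L q = N (L p) := by
  constructor
  · rintro (⟨L', h, hL⟩ | ⟨-, h⟩)
    · rwa [← P.graph_injective hL]
    · exact absurd ⟨L, rfl⟩ h
  · exact fun h => Or.inl ⟨L, h, rfl⟩

theorem mem_gluedBase_of_notMem {P : OrientedPlane E} {p q : P.plane} {N : P.planeᗮ → P.planeᗮ}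
    {K : Module.End ℝ E} {Q : OrientedPlane E} (h : Q ∉ range P.graph) :
    Q ∈ P.gluedBase p q N K ↔ Q ∈ complexLines K := by
  constructor
  · rintro (⟨L', -, hL⟩ | ⟨h', -⟩)
    · exact absurd ⟨L', hL⟩ h
    · exact h'
  · exact fun h' => Or.inr ⟨h', h⟩

namespace IsAdapted

variable {P : OrientedPlane E} {p q : P.plane} {a b : E →L[ℝ] ℝ} {J : Module.End ℝ P.planeᗮ}
  {K : Module.End ℝ E} (H : P.IsAdapted p q a b J K)

include H

theorem coord_add (s t : ℝ) (y : P.planeᗮ) : a (s • (p : E) + t • (q : E) + y) = s ∧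
    b (s • (p : E) + t • (q : E) + y) = t ∧
    P.planeᗮ.orthogonalProjectionOnto (s • (p : E) + t • (q : E) + y) = y := by
  have h := P.proj_add (s • p + t • q) y
  push_cast at h
  rw [H.proj] at h
  have h1 : a (s • (p : E) + t • (q : E) + y) • (p : E) +
      b (s • (p : E) + t • (q : E) + y) • (q : E) = s • (p : E) + t • (q : E) := by
    exact_mod_cast congrArg Subtype.val h.1
  exact ⟨(H.frame.coeff_unique h1).1, (H.frame.coeff_unique h1).2, h.2⟩

theorem eq_add (u : E) :
    u = a u • (p : E) + b u • (q : E) + P.planeᗮ.orthogonalProjectionOnto u := by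
  have := P.proj_sum u
  rw [H.proj] at this
  push_cast at this
  exact this.symm

theorem coord_map (u : E) : a (K u) = -b u ∧ b (K u) = a u := by
  have h := H.proj (K u)
  rw [H.proj_map] at h
  have h1 : (-b u) • (p : E) + a u • (q : E) = a (K u) • (p : E) + b (K u) • (q : E) := by
    exact_mod_cast congrArg Subtype.val h
  exact ⟨(H.frame.coeff_unique h1).1.symm, (H.frame.coeff_unique h1).2.symm⟩

theorem map_eq (u : E) : K u = (-b u) • (p : E) + a u • (q : E) +
    J (P.planeᗮ.orthogonalProjectionOnto u) := by
  rw [H.eq_add (K u), (H.coord_map u).1, (H.coord_map u).2, H.orth_map]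

theorem map_map (u : E) : K (K u) = -u := by
  rw [H.map_eq (K u), (H.coord_map u).1, (H.coord_map u).2, H.orth_map, H.apply_apply]
  conv_rhs => rw [H.eq_add u]
  push_cast
  module

theorem mem_graph {L : P.Tangent} {u : E} : u ∈ (P.graph L).plane ↔
    P.planeᗮ.orthogonalProjectionOnto u = a u • L p + b u • L q := by
  rw [mem_graph_iff, H.proj, map_add, map_smul, map_smul]

theorem map_graph (L : P.Tangent) : K ((p : E) + L p) = q + J (L p) := by
  have h := H.coord_add 1 0 (L p)
  rw [one_smul, zero_smul, add_zero] at h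
  rw [H.map_eq, h.1, h.2.1, h.2.2]
  simp

theorem graph_mem_complexLines {L : P.Tangent} : P.graph L ∈ complexLines K ↔ L q = J (L p) := by
  have hF := isFrame_graph H.frame L
  constructor
  · intro h
    have h1 := (isFrame_of_mem_complexLines h hF.left_mem hF.left_ne_zero).right_mem
    rw [H.map_graph] at h1
    rw [mem_graph_iff, (P.proj_add _ _).1, (P.proj_add _ _).2] at h1
    exact h1.symm
  · intro h
    refine mem_complexLines_of_isFrame H.map_map (v := (p : E) + L p) ?_
    rw [H.map_graph, ← h]
    exact hF

/-- The frame `(u, K u)` projects to `P` with determinant `a² + b² > 0`. Consequently complex lines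
outside of `N(P)` lie in `Pᗮ`. -/
theorem mem_range_graph {Q : OrientedPlane E} (hQ : Q ∈ complexLines K) {u : E} (hu : u ∈ Q.plane)
    (hab : (a u, b u) ≠ 0) : Q ∈ range P.graph := by
  have hu0 : u ≠ 0 := by
    rintro rfl
    simp at hab
  have hpos : 0 < a u * a u - b u * (-b u) := by
    rw [mul_neg, sub_neg_eq_add]
    refine lt_of_le_of_ne (add_nonneg (mul_self_nonneg _) (mul_self_nonneg _)) fun h => hab ?_
    obtain ⟨h1, h2⟩ := mul_self_add_mul_self_eq_zero.1 h.symm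
    exact Prod.ext h1 h2
  obtain ⟨L, hL, -⟩ := H.frame.mem_range_graph (isFrame_of_mem_complexLines hQ hu hu0) (H.proj u)
    (H.proj_map u) hpos
  exact ⟨L, hL⟩

theorem notMem_graph {L : P.Tangent} {u : E} (hu0 : u ≠ 0) (hab : (a u, b u) = 0) :
    u ∉ (P.graph L).plane := by
  intro h
  rw [H.mem_graph] at h
  have ha : a u = 0 := congrArg Prod.fst hab
  have hb : b u = 0 := congrArg Prod.snd hab
  rw [ha, hb, zero_smul, zero_smul, add_zero] at h
  refine hu0 ?_
  rw [H.eq_add u, ha, hb, h]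
  simp

theorem coord_eq_zero_of_notMem {Q : OrientedPlane E} (hQ : Q ∈ complexLines K)
    (hQP : Q ∉ range P.graph) {u : E} (hu : u ∈ Q.plane) : (a u, b u) = 0 := by
  by_contra h
  exact hQP (H.mem_range_graph hQ hu h)

variable {N : P.planeᗮ → P.planeᗮ} {g : (ℝ × ℝ) × P.planeᗮ → P.planeᗮ}
  (hg : ∀ θ : ℝ × ℝ, θ ≠ 0 → ∀ y, (∀ x, θ.1 • x + θ.2 • N x = y ↔ x = g (θ, y)) ∧
    ContDiffAt ℝ ∞ g (θ, y))

include hg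

/-- Such a plane is a graph, and `u` lies on it iff `a L p + b N (L p)` is the `Pᗮ`-component of
`u`, an equation that `g` solves uniquely. -/
theorem eq_graph_of_mem {Q : OrientedPlane E} (hQ : Q ∈ P.gluedBase p q N K) {u : E}
    (hu : u ∈ Q.plane) (hab : (a u, b u) ≠ 0) : ∃ L : P.Tangent, Q = P.graph L ∧
      L p = g ((a u, b u), P.planeᗮ.orthogonalProjectionOnto u) ∧
      L q = N (g ((a u, b u), P.planeᗮ.orthogonalProjectionOnto u)) := by
  rcases hQ with ⟨L, hL, rfl⟩ | ⟨h, hn⟩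
  · have h1 := H.mem_graph.1 hu
    rw [mem_ofPred_eq] at hL
    rw [hL] at h1
    have h2 := ((hg (a u, b u) hab _).1 (L p)).1 h1.symm
    exact ⟨L, rfl, h2, by rw [hL, h2]⟩
  · exact absurd (H.mem_range_graph h hu hab) hn

/-- Vectors of `Pᗮ` meet only the complex lines outside of `N(P)`, and all other vectors only the
graphs; the two cases never interfere. -/
theorem existsUnique_mem {u : E} (hu : u ≠ 0) :
    ∃! Q : OrientedPlane E, Q ∈ P.gluedBase p q N K ∧ u ∈ Q.plane := by
  by_cases hab : (a u, b u) = 0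
  · obtain ⟨Q, hQ, huQ⟩ := exists_complexLine H.map_map hu
    have hn : ∀ Q : OrientedPlane E, u ∈ Q.plane → Q ∉ range P.graph := by
      rintro _ h ⟨L, rfl⟩
      exact H.notMem_graph hu hab h
    refine ⟨Q, ⟨(mem_gluedBase_of_notMem (hn Q huQ)).2 hQ, huQ⟩, fun Q' hQ' => ?_⟩
    exact complexLine_unique hu ((mem_gluedBase_of_notMem (hn Q' hQ'.2)).1 hQ'.1) hQ hQ'.2 huQ
  · set x := g ((a u, b u), P.planeᗮ.orthogonalProjectionOnto u) with hx
    obtain ⟨L, hp, hq⟩ := exists_tangent H.frame x (N x)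
    refine ⟨P.graph L, ⟨graph_mem_gluedBase.2 (by rw [hq, hp]), ?_⟩, fun Q' hQ' => ?_⟩
    · rw [H.mem_graph, hp, hq]
      exact (((hg (a u, b u) hab _).1 x).2 hx).symm
    · obtain ⟨L', rfl, hp', hq'⟩ := H.eq_graph_of_mem hg hQ'.1 hQ'.2 hab
      rw [tangent_ext H.frame (hp'.trans hp.symm) (hq'.trans hq.symm)]

end IsAdapted

/-- The union of the complex lines of `K` which are graphs over `P` with `|L p| ≤ R`. -/
def complexCore (P : OrientedPlane E) (a b : E →L[ℝ] ℝ) (J : Module.End ℝ P.planeᗮ) (R : ℝ) :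
    Set E :=
  {u | ∃ x : P.planeᗮ, ‖x‖ ≤ R ∧ P.planeᗮ.orthogonalProjectionOnto u = a u • x + b u • J x}

theorem isClosed_complexCore [FiniteDimensional ℝ E] (P : OrientedPlane E) (a b : E →L[ℝ] ℝ)
    (J : Module.End ℝ P.planeᗮ) (R : ℝ) : IsClosed (P.complexCore a b J R) := by
  have hJ : Continuous J := J.continuous_of_finiteDimensional
  let S : Set (closedBall (0 : P.planeᗮ) R × E) :=
    {w | P.planeᗮ.orthogonalProjectionOnto w.2 = a w.2 • (w.1 : P.planeᗮ) + b w.2 • J w.1}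
  have hS : IsClosed S := isClosed_eq (by fun_prop) (by fun_prop)
  have : CompactSpace (closedBall (0 : P.planeᗮ) R) :=
    isCompact_iff_compactSpace.1 (isCompact_closedBall _ _)
  -- The core is the projection of a closed set along the compact ball of parameters `x`.
  convert isClosedMap_snd_of_compactSpace S hS using 1
  ext u
  constructor
  · rintro ⟨x, hx, h⟩
    exact ⟨(⟨x, by simpa using hx⟩, u), h, rfl⟩
  · rintro ⟨⟨⟨x, hx⟩, _⟩, h, rfl⟩
    exact ⟨x, by simpa using hx, h⟩

namespace IsAdapted

variable {P : OrientedPlane E} {p q : P.plane} {a b : E →L[ℝ] ℝ} {J : Module.End ℝ P.planeᗮ}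
  {K : Module.End ℝ E} (H : P.IsAdapted p q a b J K)

include H

theorem mem_complexCore {R : ℝ} {u : E} (hu : u ∈ P.complexCore a b J R) (s t : ℝ) :
    s • u + t • K u ∈ P.complexCore a b J R := by
  obtain ⟨x, hx, h⟩ := hu
  refine ⟨x, hx, ?_⟩
  rw [map_add, map_smul, map_smul, H.orth_map, h, map_add a, map_add b, map_smul a, map_smul b,
    map_smul a, map_smul b, (H.coord_map u).1, (H.coord_map u).2, map_add J, map_smul J, map_smul J,
    H.apply_apply]
  simp only [smul_eq_mul]
  module

theorem mem_complexCore_iff {R : ℝ} {u : E} {s t : ℝ} (hst : s * s + t * t ≠ 0) :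
    s • u + t • K u ∈ P.complexCore a b J R ↔ u ∈ P.complexCore a b J R := by
  refine ⟨fun h => ?_, fun h => H.mem_complexCore h s t⟩
  -- Multiplication by the complex number `s + i t` is undone by `(s - i t) / (s² + t²)`.
  have h1 := H.mem_complexCore h (s / (s * s + t * t)) (-t / (s * s + t * t))
  rw [map_add, map_smul, map_smul, H.map_map] at h1
  convert h1 using 1
  match_scalars
  · field_simp
    rw [eq_div_iff (by convert hst using 1; ring), one_mul]
  · field_simp
    ring

theorem notMem_complexCore {R : ℝ} {u : E} (hu0 : u ≠ 0) (hab : (a u, b u) = 0) :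
    u ∉ P.complexCore a b J R := by
  rintro ⟨x, -, h⟩
  have ha : a u = 0 := congrArg Prod.fst hab
  have hb : b u = 0 := congrArg Prod.snd hab
  rw [ha, hb, zero_smul, zero_smul, add_zero] at h
  refine hu0 ?_
  rw [H.eq_add u, ha, hb, h]
  simp

variable {N : P.planeᗮ → P.planeᗮ} {g : (ℝ × ℝ) × P.planeᗮ → P.planeᗮ}
  (hg : ∀ θ : ℝ × ℝ, θ ≠ 0 → ∀ y, (∀ x, θ.1 • x + θ.2 • N x = y ↔ x = g (θ, y)) ∧
    ContDiffAt ℝ ∞ g (θ, y))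
  {R : ℝ} (hR : ∀ x, R ≤ ‖x‖ → N x = J x)

include hR in
theorem mem_gluedBase_of_mem_complexLines {Q : OrientedPlane E} (hQ : Q ∈ complexLines K) {u : E}
    (hu : u ∈ Q.plane) (huR : u ∉ P.complexCore a b J R) : Q ∈ P.gluedBase p q N K := by
  by_cases hQP : Q ∈ range P.graph
  · obtain ⟨L, rfl⟩ := hQP
    have h1 := H.graph_mem_complexLines.1 hQ
    have h2 := H.mem_graph.1 hu
    rw [h1] at h2
    have h3 : R < ‖L p‖ := by
      by_contra! h
      exact huR ⟨L p, h, h2⟩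
    exact graph_mem_gluedBase.2 (by rw [h1, hR _ h3.le])
  · exact (mem_gluedBase_of_notMem hQP).2 hQ

include hg hR in
-- Off the core `N` agrees with `J`, so the complex line through `u` belongs to the glued family. By
-- uniqueness it is the only member through `u`.
theorem mem_gluedBase_iff {Q : OrientedPlane E} {u : E} (hu : u ∈ Q.plane) (hu0 : u ≠ 0)
    (huR : u ∉ P.complexCore a b J R) : Q ∈ P.gluedBase p q N K ↔ Q ∈ complexLines K := by
  refine ⟨fun h => ?_, fun h => H.mem_gluedBase_of_mem_complexLines hR h hu huR⟩
  obtain ⟨Q', hQ', huQ'⟩ := exists_complexLine H.map_map hu0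
  have h' := H.mem_gluedBase_of_mem_complexLines hR hQ' huQ' huR
  rwa [(H.existsUnique_mem hg hu0).unique ⟨h, hu⟩ ⟨h', huQ'⟩]

end IsAdapted

end OrientedPlane

/-! ### Local triviality off `Pᗮ` and near `Pᗮ`. -/

namespace OrientedPlane

variable {E : Type*} [NormedAddCommGroup E] [InnerProductSpace ℝ E]

namespace IsAdapted

variable {P : OrientedPlane E} {p q : P.plane} {a b : E →L[ℝ] ℝ} {J : Module.End ℝ P.planeᗮ}
  {K : Module.End ℝ E} (H : P.IsAdapted p q a b J K)
  {N : P.planeᗮ → P.planeᗮ} {g : (ℝ × ℝ) × P.planeᗮ → P.planeᗮ}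
  (hg : ∀ θ : ℝ × ℝ, θ ≠ 0 → ∀ y, (∀ x, θ.1 • x + θ.2 • N x = y ↔ x = g (θ, y)) ∧
    ContDiffAt ℝ ∞ g (θ, y))
  {n : ℕ} [Fact (Module.finrank ℝ E = 2 * n + 1 + 1)] [FiniteDimensional ℝ E]
  {π : sphere (0 : E) 1 → OrientedPlane E} (hself : ∀ u, (u : E) ∈ (π u).plane)
  (hM : ∀ u, π u ∈ P.gluedBase p q N K)

include H hg hself hM

/-- One trivialization serves the whole complement of `Pᗮ`: the base coordinate is `L p`, computed
by `g`, and the fibre coordinate is `(a u, b u)`. -/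
theorem isLocallyTrivialAt_of_ne_zero (hN : ContDiff ℝ ∞ N)
    (hn : Module.finrank ℝ P.planeᗮ = 2 * n) {v : sphere (0 : E) 1} (hv : (a v, b v) ≠ 0) :
    ContinuousAt π v ∧ IsLocallyTrivialAt n π v := by
  let ι : EuclideanSpace ℝ (Fin (2 * n)) ≃L[ℝ] P.planeᗮ :=
    ContinuousLinearEquiv.ofFinrankEq (by rw [hn, finrank_euclideanSpace_fin])
  have hF : ∀ x y : P.planeᗮ, ∃ Q : OrientedPlane E, Q.IsFrame ((p : E) + x) (q + y) :=
    fun x y => by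
      obtain ⟨L, hp, hq⟩ := exists_tangent H.frame x y
      exact ⟨P.graph L, hp ▸ hq ▸ isFrame_graph H.frame L⟩
  let po : E →L[ℝ] P.planeᗮ := P.planeᗮ.orthogonalProjectionOnto
  let g' : E → EuclideanSpace ℝ (Fin (2 * n)) := fun u => ι.symm (g ((a u, b u), po u))
  have hιN : ContDiff ℝ ∞ fun d => N (ι d) := hN.comp ι.contDiff
  have hcoe : ContDiff ℝ ∞ (fun x : P.planeᗮ => (x : E)) := P.planeᗮ.subtypeL.contDiff
  have key : ∀ u : E, (a u, b u) ≠ 0 → u = a u • ((p : E) + ι (g' u)) + b u • (q + N (ι (g' u))) :=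
    fun u hu => by
      have h1 := ((hg (a u, b u) hu (po u)).1 (ι (g' u))).2 (by simp [g'])
      conv_lhs => rw [H.eq_add u]
      change _ + (po u : E) = _
      rw [← h1]
      push_cast
      module
  refine exists_fibre_chart hself (s₀ := fun d => (p : E) + ι d) (s₁ := fun d => (q : E) + N (ι d))
    (contDiff_const.add (hcoe.comp ι.contDiff)) (contDiff_const.add (hcoe.comp hιN)) ?_
    isOpen_univ (Ω := {u | (a u, b u) ≠ 0}) ?_ (g := g') (h := fun u => !₂[a u, b u])
    ?_ ?_ (fun _ _ => mem_univ _) ?_ ?_ ?_ hv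
  · intro x s t hst
    obtain ⟨Q, hQ⟩ := hF (ι x) (N (ι x))
    exact hQ.coeff_eq_zero hst
  · exact isOpen_ne_fun (a.continuous.prodMk b.continuous) continuous_const
  · intro u hu
    have h1 : ContDiffAt ℝ ∞ (fun u => ((a u, b u), po u)) u :=
      ((a.contDiff.prodMk b.contDiff).prodMk po.contDiff).contDiffAt
    exact ι.symm.contDiff.contDiffAt.comp u (((hg _ hu (po u)).2).comp u h1)
  · intro u _
    refine ContDiff.contDiffAt ?_
    rw [contDiff_euclidean]
    intro i
    fin_cases i
    · exact a.contDiff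
    · exact b.contDiff
  · intro u hu
    simpa using key u hu
  · intro d _ θ hθ
    have e : θ 0 • ((p : E) + ι d) + θ 1 • ((q : E) + N (ι d)) =
        θ 0 • (p : E) + θ 1 • (q : E) + (θ 0 • ι d + θ 1 • N (ι d) : P.planeᗮ) := by
      push_cast
      module
    obtain ⟨h1, h2, h3⟩ := H.coord_add (θ 0) (θ 1) (θ 0 • ι d + θ 1 • N (ι d))
    have hθ' : ((θ 0, θ 1) : ℝ × ℝ) ≠ 0 := fun h0 => hθ (by
      ext i
      fin_cases i
      · exact congrArg Prod.fst h0
      · exact congrArg Prod.snd h0)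
    rw [e]
    refine ⟨?_, ?_, ?_⟩
    · rw [mem_ofPred_eq, h1, h2]
      exact hθ'
    · have h4 := ((hg _ hθ' (θ 0 • ι d + θ 1 • N (ι d))).1 (ι d)).1 rfl
      simp only [g', po]
      rw [h1, h2, h3, ← h4, ι.symm_apply_apply]
    · ext i
      fin_cases i
      · exact h1
      · exact h2
  · intro u hu
    obtain ⟨L, hL, hp, hq⟩ := H.eq_graph_of_mem hg (hM u) (hself u) hu
    have h1 := isFrame_graph H.frame L
    have h2 : ι (g' u) = L p := by rw [hp]; simp [g', po]
    simp only [h2]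
    rw [hp, ← hq, ← hp, hL]
    exact h1

/-- Off the core the family consists of complex lines. The affine chart of projective space at `v`
applies: a line on which a complex linear functional with value `1` at `v` does not vanish meets the
affine space `v + W`, `W` its kernel, in one point. -/
theorem isLocallyTrivialAt_of_eq_zero {R : ℝ} (hR : ∀ x, R ≤ ‖x‖ → N x = J x)
    {v : sphere (0 : E) 1} (hv : (a v, b v) = 0) :
    ContinuousAt π v ∧ IsLocallyTrivialAt n π v := by
  have hv0 : (v : E) ≠ 0 := ne_zero_of_mem_unit_sphere v
  have hKK := H.map_map
  obtain ⟨l, hl1, hl2⟩ : ∃ l : E →L[ℝ] ℝ, l v = 1 ∧ l (K v) = 0 := by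
    obtain ⟨Q, hQ⟩ := exists_isFrame fun s t => linearIndependent_complex hKK hv0 (s := s) (t := t)
    let v' : Q.plane := ⟨v, hQ.left_mem⟩
    let w' : Q.plane := ⟨K v, hQ.right_mem⟩
    have hQ' : Q.IsFrame v' w' := hQ
    obtain ⟨c, -, -, h1, h2, -, -⟩ := exists_coord hQ'
    refine ⟨c ∘L Q.plane.orthogonalProjectionOnto, ?_, ?_⟩
    · exact (congrArg c (Submodule.orthogonalProjectionOnto_mem_subspace_eq_self v')).trans h1
    · exact (congrArg c (Submodule.orthogonalProjectionOnto_mem_subspace_eq_self w')).trans h2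
  let Kc : E →L[ℝ] E := LinearMap.toContinuousLinearMap K
  -- `l + i m` is complex linear for `K`, with value `1` at `v`.
  let m : E →L[ℝ] ℝ := -(l ∘L Kc)
  have hm : ∀ u, m u = -l (K u) := fun u => rfl
  have hlK : ∀ u, l (K u) = -m u := fun u => by rw [hm, neg_neg]
  have hmK : ∀ u, m (K u) = l u := fun u => by rw [hm, hKK, map_neg, neg_neg]
  have hmv : m v = 0 := by rw [hm, hl2, neg_zero]
  let lm : E →ₗ[ℝ] ℝ × ℝ := (l : E →ₗ[ℝ] ℝ).prod (m : E →ₗ[ℝ] ℝ)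
  let W : Submodule ℝ E := LinearMap.ker lm
  have hW : ∀ w, w ∈ W ↔ l w = 0 ∧ m w = 0 := fun w => by
    rw [LinearMap.mem_ker]
    exact Prod.ext_iff
  have hWl : ∀ w : W, l w = 0 := fun w => ((hW w).1 w.2).1
  have hWm : ∀ w : W, m w = 0 := fun w => ((hW w).1 w.2).2
  have hWdim : Module.finrank ℝ W = 2 * n := by
    have h1 := LinearMap.finrank_range_add_finrank_ker lm
    have h2 : LinearMap.range lm = ⊤ := by
      rw [LinearMap.range_eq_top]
      rintro ⟨s, t⟩
      refine ⟨s • v + t • K v, Prod.ext ?_ ?_⟩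
      · change l _ = s
        rw [map_add, map_smul, map_smul, hl1, hl2]
        simp
      · change m _ = t
        rw [map_add, map_smul, map_smul, hmK, hl1, hmv]
        simp
    rw [h2, finrank_top, Fact.out (p := Module.finrank ℝ E = 2 * n + 1 + 1)] at h1
    simp only [Module.finrank_prod, Module.finrank_self] at h1
    change 1 + 1 + Module.finrank ℝ W = _ at h1
    omega
  let κ : EuclideanSpace ℝ (Fin (2 * n)) ≃L[ℝ] W :=
    ContinuousLinearEquiv.ofFinrankEq (by rw [hWdim, finrank_euclideanSpace_fin])
  let prE : E →L[ℝ] E := ContinuousLinearMap.id ℝ E - l.smulRight (v : E) - m.smulRight (K v)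
  have hprE : ∀ u, prE u = u - l u • (v : E) - m u • K v := fun u => rfl
  let prW : E →L[ℝ] W := prE.codRestrict W fun u => by
    rw [hW, hprE]
    simp only [map_sub, map_smul, hl1, hl2, hmK, hmv, smul_eq_mul]
    constructor <;> ring
  let r : E → ℝ := fun u => l u * l u + m u * m u
  -- `w u` is `u` divided by the complex number `l u + i m u`: the point of `v + W` on the complex
  -- line of `u`.
  let w : E → E := fun u => (r u)⁻¹ • (l u • u - m u • K u)
  let g' : E → EuclideanSpace ℝ (Fin (2 * n)) := fun u => κ.symm (prW (w u))
  let Ω : Set E := {u | (l u, m u) ≠ 0} ∩ (P.complexCore a b J R)ᶜ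
  have hr : ∀ u, (l u, m u) ≠ 0 → r u ≠ 0 := fun u hu h0 => by
    obtain ⟨h1, h2⟩ := mul_self_add_mul_self_eq_zero.1 h0
    exact hu (Prod.ext h1 h2)
  have hlw : ∀ u, (l u, m u) ≠ 0 → l (w u) = 1 ∧ m (w u) = 0 := fun u hu => by
    have h1 := hr u hu
    simp only [w, map_smul, map_sub, hlK, hmK, smul_eq_mul]
    constructor
    · rw [mul_neg, sub_neg_eq_add]
      exact inv_mul_cancel₀ h1
    · ring
  have hκg : ∀ u, (l u, m u) ≠ 0 → (v : E) + κ (g' u) = w u := fun u hu => by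
    have h1 : (κ (g' u) : E) = prE (w u) := by
      simp only [g', κ.apply_symm_apply]
      rfl
    rw [h1, hprE, (hlw u hu).1, (hlw u hu).2]
    simp
  have hwcore : ∀ u, (l u, m u) ≠ 0 → u ∉ P.complexCore a b J R → w u ∉ P.complexCore a b J R :=
    fun u hu hu' => by
      have h1 := hr u hu
      have e : w u = ((r u)⁻¹ * l u) • u + (-((r u)⁻¹ * m u)) • K u := by
        simp only [w]
        module
      rw [e, H.mem_complexCore_iff]
      · exact hu'
      · have : (r u)⁻¹ * l u * ((r u)⁻¹ * l u) + -((r u)⁻¹ * m u) * -((r u)⁻¹ * m u) =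
            (r u)⁻¹ * (r u)⁻¹ * r u := by simp only [r]; ring
        rw [this]
        exact mul_ne_zero (mul_ne_zero (inv_ne_zero h1) (inv_ne_zero h1)) h1
  have hne : ∀ d, (v : E) + κ d ≠ 0 := fun d h0 => by
    have h1 := congrArg l h0
    rw [map_add, hl1, hWl, map_zero] at h1
    norm_num at h1
  have hcoe : ContDiff ℝ ∞ (fun x : W => (x : E)) := W.subtypeL.contDiff
  have hs : ContDiff ℝ ∞ fun d => (v : E) + κ d := contDiff_const.add (hcoe.comp κ.contDiff)
  have hcore := isClosed_complexCore P a b J R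
  have huw : ∀ u, (l u, m u) ≠ 0 → u = l u • w u + m u • K (w u) := fun u hu => by
    have h1 := hr u hu
    have e : l u • w u + m u • K (w u) = ((r u)⁻¹ * r u) • u := by
      simp only [w, map_smul, map_sub, hKK, r]
      module
    rw [e, inv_mul_cancel₀ h1, one_smul]
  refine exists_fibre_chart hself (s₀ := fun d => (v : E) + κ d) (s₁ := fun d => K ((v : E) + κ d))
    hs (Kc.contDiff.comp hs) (fun x s t => linearIndependent_complex hKK (hne x))
    (D := {d | (v : E) + κ d ∉ P.complexCore a b J R}) ?_
    (Ω := Ω) ?_ (g := g') (h := fun u => !₂[l u, m u])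
    ?_ ?_ ?_ ?_ ?_ ?_ ?_
  · exact hcore.isOpen_compl.preimage hs.continuous
  · exact (isOpen_ne_fun (l.continuous.prodMk m.continuous) continuous_const).inter
      hcore.isOpen_compl
  · intro u hu
    have h1 : ContDiffAt ℝ ∞ w u := by
      refine ContDiffAt.smul ?_ ?_
      · exact (((l.contDiff.mul l.contDiff).add (m.contDiff.mul m.contDiff)).contDiffAt).inv
          (hr u hu.1)
      · exact ((l.contDiff.smul contDiff_id).sub (m.contDiff.smul Kc.contDiff)).contDiffAt
    exact κ.symm.contDiff.contDiffAt.comp u (prW.contDiff.contDiffAt.comp u h1)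
  · intro u _
    refine ContDiff.contDiffAt ?_
    rw [contDiff_euclidean]
    intro i
    fin_cases i
    · exact l.contDiff
    · exact m.contDiff
  · intro u hu
    rw [mem_ofPred_eq, hκg u hu.1]
    exact hwcore u hu.1 hu.2
  · intro u hu
    simp only [hκg u hu.1]
    simpa using huw u hu.1
  · intro d hd θ hθ
    have hx : l (v + κ d) = 1 ∧ m (v + κ d) = 0 := by
      rw [map_add, map_add, hl1, hmv, hWl, hWm]
      simp
    set x : E := v + κ d with hxdef
    clear_value x
    set u : E := θ 0 • x + θ 1 • K x with hu
    clear_value u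
    have e1 : l u = θ 0 := by
      rw [hu, map_add, map_smul, map_smul, hlK, hx.1, hx.2]
      simp
    have e2 : m u = θ 1 := by
      rw [hu, map_add, map_smul, map_smul, hmK, hx.1, hx.2]
      simp
    have hθ' : ((l u, m u) : ℝ × ℝ) ≠ 0 := fun h0 => hθ (by
      ext i
      fin_cases i
      · exact e1.symm.trans (congrArg Prod.fst h0)
      · exact e2.symm.trans (congrArg Prod.snd h0))
    have h1 := hr u hθ'
    have hwx : w u = x := by
      have e3 : w u = ((r u)⁻¹ * r u) • x := by
        simp only [w, r, e1, e2]
        rw [hu, map_add, map_smul, map_smul, hKK]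
        module
      rw [e3, inv_mul_cancel₀ h1, one_smul]
    refine ⟨⟨hθ', ?_⟩, ?_, ?_⟩
    · rw [mem_compl_iff, hu, H.mem_complexCore_iff]
      · rw [hxdef]
        exact hd
      · simpa only [r, e1, e2] using h1
    · have h2 := hκg u hθ'
      rw [hwx, hxdef] at h2
      exact κ.injective (Subtype.ext (add_left_cancel h2))
    · ext i
      fin_cases i
      · exact e1
      · exact e2
  · intro u hu
    have hu0 : (u : E) ≠ 0 := ne_zero_of_mem_unit_sphere u
    have hQ := (H.mem_gluedBase_iff hg hR (hself u) hu0 hu.2).1 (hM u)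
    have hF := isFrame_of_mem_complexLines hQ (hself u) hu0
    have hwmem : w u ∈ (π u).plane :=
      (π u).plane.smul_mem _ (sub_mem ((π u).plane.smul_mem _ hF.left_mem)
        ((π u).plane.smul_mem _ hF.right_mem))
    have hw0 : w u ≠ 0 := hκg u hu.1 ▸ hne _
    simp only [hκg u hu.1]
    exact isFrame_of_mem_complexLines hQ hwmem hw0
  · refine ⟨fun h0 => ?_, H.notMem_complexCore hv0 hv⟩
    have h1 := congrArg Prod.fst h0
    simp only [hl1] at h1
    exact one_ne_zero h1

end IsAdapted

end OrientedPlane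

/-! ### Transverse subspaces, global properties of the family, and the proposition. -/

theorem posTangentConeAt_submodule {V : Type*} [NormedAddCommGroup V] [NormedSpace ℝ V]
    (T : Submodule ℝ V) (hT : IsClosed (T : Set V)) : posTangentConeAt (T : Set V) 0 = T := by
  refine Subset.antisymm (fun y hy => ?_) fun y hy => ?_
  · obtain ⟨α, l, hl, c, d, -, hd, hcd⟩ := exists_fun_of_mem_tangentConeAt hy
    refine hT.mem_of_tendsto hcd (hd.mono fun n hn => ?_)
    rw [zero_add] at hn
    exact T.smul_mem (c n : ℝ) hn
  · refine mem_posTangentConeAt_of_segment_subset ?_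
    rw [zero_add]
    exact T.convex.segment_subset T.zero_mem hy

namespace OrientedPlane

variable {E : Type*} [NormedAddCommGroup E] [InnerProductSpace ℝ E]

theorem finrank_orthogonal {n : ℕ} [hn : Fact (Module.finrank ℝ E = 2 * n + 1 + 1)]
    [FiniteDimensional ℝ E] (P : OrientedPlane E) : Module.finrank ℝ P.planeᗮ = 2 * n := by
  have h1 := Submodule.finrank_add_finrank_orthogonal P.plane
  rw [P.finrank_plane, hn.out] at h1
  omega

theorem graph_zero (P : OrientedPlane E) : P.graph 0 = P := by
  obtain ⟨p, q, h⟩ := P.exists_frame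
  have h1 := isFrame_graph h 0
  simp only [zero_apply, ZeroMemClass.coe_zero, add_zero] at h1
  exact h1.unique h

/-- The maps which are not injective belong to the bad cone. -/
theorem mem_badCone_of_apply_eq_zero {P : OrientedPlane E} {L : P.Tangent} {v : P.plane}
    (hv : v ≠ 0) (hL : L v = 0) : L ∈ P.badCone := by
  refine mem_posTangentConeAt_of_segment_subset (E := P.Tangent) ?_
  rintro _ ⟨s, t, -, -, -, rfl⟩
  have h1 : (v : E) ∈ P.plane ⊓ (P.graph (s • (0 : P.Tangent) + t • (0 + L))).plane := by
    refine ⟨v.2, v, ?_⟩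
    rw [graphMap_apply]
    simp [hL]
  intro h2
  rw [h2, Submodule.mem_bot] at h1
  exact hv (Subtype.ext h1)

/-- Transversality enters only through the injectivity of the nonzero elements of `T`. At `e 0` it
yields `A` as evaluation at `e 1` after the inverse of evaluation at `e 0`; at `e 1 - μ • e 0` it
excludes the eigenvalue `μ`. -/
theorem exists_eq_graphSubspace [FiniteDimensional ℝ E] {P : OrientedPlane E}
    (e : OrthonormalBasis (Fin 2) ℝ P.plane) (hP : P.IsFrame (e 0) (e 1))
    {T : Submodule ℝ P.Tangent} (hT : Module.finrank ℝ T = Module.finrank ℝ P.planeᗮ)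
    (hTP : P.IsTransverseToBadCone T) :
    ∃ A : Module.End ℝ P.planeᗮ, HasNoRealEigenvalues A ∧ T = P.graphSubspace e A := by
  have : FiniteDimensional ℝ P.Tangent :=
    Module.Finite.equiv (LinearMap.toContinuousLinearMap (𝕜 := ℝ) (E := P.plane) (F' := P.planeᗮ))
  have hinj : ∀ L ∈ T, ∀ v : P.plane, v ≠ 0 → L v = 0 → L = 0 := fun L hL v hv hLv => by
    have h1 : L ∈ (T : Set P.Tangent) ∩ P.badCone := ⟨hL, mem_badCone_of_apply_eq_zero hv hLv⟩
    rwa [hTP] at h1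
  have he : ∀ i, e i ≠ 0 := fun i => by
    simpa using e.toBasis.ne_zero i
  let ev : T →ₗ[ℝ] P.planeᗮ :=
    (ContinuousLinearMap.apply ℝ P.planeᗮ (e 0)).toLinearMap ∘ₗ T.subtype
  have hev : Function.Injective ev := by
    rw [injective_iff_map_eq_zero]
    intro L hL
    exact Subtype.ext (hinj L L.2 (e 0) (he 0) hL)
  let Φ : T ≃ₗ[ℝ] P.planeᗮ := LinearEquiv.ofBijective ev
    ⟨hev, (LinearMap.injective_iff_surjective_of_finrank_eq_finrank (K := ℝ) (V := T)
      (V₂ := P.planeᗮ) hT).1 hev⟩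
  have hΦ : ∀ L : T, Φ L = (L : P.Tangent) (e 0) := fun L => rfl
  let A : Module.End ℝ P.planeᗮ :=
    (ContinuousLinearMap.apply ℝ P.planeᗮ (e 1)).toLinearMap ∘ₗ T.subtype ∘ₗ
      (Φ.symm : P.planeᗮ →ₗ[ℝ] T)
  have hA : ∀ L : T, (L : P.Tangent) (e 1) = A ((L : P.Tangent) (e 0)) := fun L => by
    change _ = (Φ.symm ((L : P.Tangent) (e 0)) : P.Tangent) (e 1)
    rw [← hΦ, Φ.symm_apply_apply]
  refine ⟨A, fun μ hμ => ?_, ?_⟩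
  · obtain ⟨x, hx⟩ := hμ.exists_hasEigenvector
    have h1 := hx.apply_eq_smul
    obtain ⟨L, rfl⟩ := Φ.surjective x
    rw [hΦ, ← hA] at h1
    have h2 : (e 1 - μ • e 0 : P.plane) ≠ 0 := fun h0 => by
      have h3 : (-μ) • (e 0 : E) + (1 : ℝ) • (e 1 : E) = 0 := by
        have := congrArg Subtype.val h0
        push_cast at this
        rw [← this]
        module
      exact one_ne_zero (hP.coeff_eq_zero h3).2
    have h3 := hinj L L.2 _ h2 (by rw [map_sub, map_smul, h1, sub_self])
    refine hx.2 ?_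
    rw [hΦ, h3]
    rfl
  · ext L
    refine ⟨fun h => hA ⟨L, h⟩, fun h => ?_⟩
    have h : L (e 1) = A (L (e 0)) := h
    have h1 : (Φ.symm (L (e 0)) : P.Tangent) (e 0) = L (e 0) := by
      rw [← hΦ, Φ.apply_symm_apply]
    have h2 : (Φ.symm (L (e 0)) : P.Tangent) = L :=
      tangent_ext hP h1 (by rw [hA, h1, h])
    rw [← h2]
    exact (Φ.symm (L (e 0))).2

theorem exists_isAdapted {P : OrientedPlane E} (e : OrthonormalBasis (Fin 2) ℝ P.plane)
    (hP : P.IsFrame (e 0) (e 1)) {J : Module.End ℝ P.planeᗮ} (hJ : ∀ x, J (J x) = -x) :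
    ∃ a b : E →L[ℝ] ℝ, P.IsAdapted (e 0) (e 1) a b J (P.extendComplexStructure e J) := by
  obtain ⟨c, d, hcd, -, -, -, -⟩ := exists_coord hP
  have hK : ∀ u, P.extendComplexStructure e J u =
      (e.toBasis.constr ℝ ![e 1, -e 0] (P.plane.orthogonalProjectionOnto u) : P.plane) +
        (J (P.planeᗮ.orthogonalProjectionOnto u) : E) := fun u => rfl
  refine ⟨c ∘L P.plane.orthogonalProjectionOnto, d ∘L P.plane.orthogonalProjectionOnto, hP,
    fun u => hcd _, fun u => ?_, fun u => ?_, hJ⟩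
  · rw [hK, (P.proj_add _ _).1]
    conv_lhs => rw [hcd (P.plane.orthogonalProjectionOnto u)]
    have h0 : e.toBasis.constr ℝ ![e 1, -e 0] (e 0) = e 1 := by
      simp
    have h1 : e.toBasis.constr ℝ ![e 1, -e 0] (e 1) = -e 0 := by
      simp
    rw [map_add, map_smul, map_smul, h0, h1]
    simp only [ContinuousLinearMap.comp_apply]
    module
  · rw [hK, (P.proj_add _ _).2]

namespace IsAdapted

variable {P : OrientedPlane E} {p q : P.plane} {a b : E →L[ℝ] ℝ} {J : Module.End ℝ P.planeᗮ}
  {K : Module.End ℝ E} (H : P.IsAdapted p q a b J K)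
  {N : P.planeᗮ → P.planeᗮ} {g : (ℝ × ℝ) × P.planeᗮ → P.planeᗮ}
  (hg : ∀ θ : ℝ × ℝ, θ ≠ 0 → ∀ y, (∀ x, θ.1 • x + θ.2 • N x = y ↔ x = g (θ, y)) ∧
    ContDiffAt ℝ ∞ g (θ, y))
  {n : ℕ} [Fact (Module.finrank ℝ E = 2 * n + 1 + 1)] [FiniteDimensional ℝ E]
  (hN : ContDiff ℝ ∞ N) {R : ℝ} (hR : ∀ x, R ≤ ‖x‖ → N x = J x)

include H hg hN hR

theorem exists_fibre_map : ∃ π : sphere (0 : E) 1 → OrientedPlane E, Continuous π ∧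
    (∀ v : sphere (0 : E) 1, ∀ Q : OrientedPlane E,
      (Q ∈ P.gluedBase p q N K ∧ (v : E) ∈ Q.plane) ↔ Q = π v) ∧
    ∀ v, IsLocallyTrivialAt n π v := by
  choose π hπ hπu using fun v : sphere (0 : E) 1 =>
    H.existsUnique_mem hg (ne_zero_of_mem_unit_sphere v)
  have key : ∀ v, ContinuousAt π v ∧ IsLocallyTrivialAt n π v := fun v => by
    by_cases hv : (a v, b v) = 0
    · exact H.isLocallyTrivialAt_of_eq_zero hg (fun u => (hπ u).2) (fun u => (hπ u).1) hR hv
    · exact H.isLocallyTrivialAt_of_ne_zero hg (fun u => (hπ u).2) (fun u => (hπ u).1) hN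
        P.finrank_orthogonal hv
  refine ⟨π, continuous_iff_continuousAt.2 fun v => (key v).1, fun v Q => ⟨hπu v Q, ?_⟩,
    fun v => (key v).2⟩
  rintro rfl
  exact hπ v

theorem isSmoothGreatCircleFibration :
    IsSmoothGreatCircleFibration n (P.gluedBase p q N K) :=
  H.exists_fibre_map hg hN hR

theorem isClosedSmoothSubmanifold :
    IsClosedSmoothSubmanifold (2 * n) (P.gluedBase p q N K) := by
  constructor
  · obtain ⟨π, hπ, hπM, -⟩ := H.exists_fibre_map hg (n := n) hN hR
    have : P.gluedBase p q N K = range π := by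
      ext Q
      constructor
      · intro hQ
        obtain ⟨u, w, hF⟩ := Q.exists_frame
        have hu := hF.left_ne_zero
        refine ⟨⟨‖(u : E)‖⁻¹ • (u : E), ?_⟩, ((hπM _ Q).1 ⟨hQ, ?_⟩).symm⟩
        · rw [mem_sphere_zero_iff_norm, norm_smul, norm_inv, norm_norm,
            inv_mul_cancel₀ (norm_ne_zero_iff.2 hu)]
        · exact Q.plane.smul_mem _ u.2
      · rintro ⟨v, rfl⟩
        exact ((hπM v _).2 rfl).1
    rw [this]
    exact isCompact_range hπ
  · intro Q hQ
    by_cases hQP : Q ∈ range P.graph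
    · obtain ⟨L, rfl⟩ := hQP
      refine ⟨P, L, rfl, ?_⟩
      rw [← P.finrank_orthogonal (n := n)]
      exact isSmoothSubmanifoldNear_of_graph H.frame isOpen_univ hN.contDiffOn isOpen_univ
        (mem_univ _) (mem_univ _) fun L _ _ => graph_mem_gluedBase
    · have hQc := (mem_gluedBase_of_notMem hQP).1 hQ
      refine ⟨Q, 0, Q.graph_zero, ?_⟩
      obtain ⟨p', q', hF, O, G, hO, hO0, hG, hgr⟩ := exists_slice_complexLines H.map_map hQc
      -- A complex line `Q` outside of `N(P)` lies in `Pᗮ`, hence `p'` is off the closed core. For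
      -- `L` near `0` the vector `p' + L p'` stays off it, so there the family is the set of complex
      -- lines.
      let U : Set Q.Tangent := {L | (p' : E) + L p' ∉ P.complexCore a b J R}
      have hU : IsOpen U := by
        refine (isClosed_complexCore P a b J R).isOpen_compl.preimage
          (f := fun L : Q.Tangent => (p' : E) + L p') ?_
        exact continuous_const.add (continuous_subtype_val.comp
          (ContinuousLinearMap.apply ℝ Q.planeᗮ p').continuous)
      rw [← Q.finrank_orthogonal (n := n)]
      refine isSmoothSubmanifoldNear_of_graph hF hO hG hU ?_ hO0 fun L hL hLO => ?_
      · have h1 := H.notMem_complexCore (R := R) hF.left_ne_zero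
          (H.coord_eq_zero_of_notMem hQc hQP p'.2)
        simpa [U] using h1
      · have hF' := isFrame_graph hF L
        rw [← hgr L hLO]
        exact H.mem_gluedBase_iff hg hR hF'.left_mem hF'.left_ne_zero hL

end IsAdapted

/-- Outside of a neighbourhood of `P`, the glued set only depends on the values of `N` outside of
a neighbourhood of the origin. -/
theorem exists_gluedBase_diff_eq {P : OrientedPlane E} {p q : P.plane} {a b : E →L[ℝ] ℝ}
    {J : Module.End ℝ P.planeᗮ} {K : Module.End ℝ E} (H : P.IsAdapted p q a b J K) (C : ℝ)
    (hC : ∀ x, ‖J x‖ ≤ C * ‖x‖) {U : Set (OrientedPlane E)} (hU : U ∈ 𝓝 P) :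
    ∃ δ : ℝ, 0 < δ ∧ ∀ N : P.planeᗮ → P.planeᗮ, (∀ x, ‖N x‖ ≤ C * ‖x‖) →
      (∀ x, δ ≤ ‖x‖ → N x = J x) → P.gluedBase p q N K \ U = complexLines K \ U := by
  have hU' : P.graph ⁻¹' U ∈ 𝓝 0 :=
    P.continuous_graph.continuousAt.preimage_mem_nhds (by rwa [P.graph_zero])
  obtain ⟨ρ, hρ, hρU⟩ := Metric.mem_nhds_iff (α := P.Tangent).1 hU'
  obtain ⟨c, d, -, hcp, hcq, hdp, hdq⟩ := exists_coord H.frame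
  have hnorm : ∀ L : P.Tangent, ‖L‖ ≤ ‖c‖ * ‖L p‖ + ‖d‖ * ‖L q‖ := fun L => by
    have h1 : L = c.smulRight (L p) + d.smulRight (L q) :=
      tangent_ext H.frame (by simp [hcp, hdp]) (by simp [hcq, hdq])
    calc ‖L‖ = ‖c.smulRight (L p) + d.smulRight (L q)‖ := by rw [← h1]
      _ ≤ ‖c.smulRight (L p)‖ + ‖d.smulRight (L q)‖ := ContinuousLinearMap.opNorm_add_le _ _
      _ = _ := by rw [ContinuousLinearMap.norm_smulRight_apply,
          ContinuousLinearMap.norm_smulRight_apply]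
  -- On the graphs of both `N` and `J` one has `‖L q‖ ≤ C ‖L p‖`, so that `‖L‖ ≤ D ‖L p‖`. A small
  -- `L p` alone therefore puts the plane in `U`.
  set D : ℝ := ‖c‖ + ‖d‖ * |C| + 1 with hD
  have hD0 : 0 < D := by positivity
  refine ⟨ρ / D, by positivity, fun N hN hNJ => ?_⟩
  have hsmall : ∀ L : P.Tangent, ‖L p‖ < ρ / D → ‖L q‖ ≤ C * ‖L p‖ → P.graph L ∈ U :=
    fun L hp hq => by
      refine hρU ((mem_ball_zero_iff (E := P.Tangent)).2 ?_)
      have h1 : ‖L q‖ ≤ |C| * ‖L p‖ :=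
        hq.trans (mul_le_mul_of_nonneg_right (le_abs_self C) (norm_nonneg _))
      calc ‖L‖ ≤ ‖c‖ * ‖L p‖ + ‖d‖ * ‖L q‖ := hnorm L
        _ ≤ ‖c‖ * ‖L p‖ + ‖d‖ * (|C| * ‖L p‖) := by gcongr
        _ ≤ D * ‖L p‖ := by rw [hD]; nlinarith [norm_nonneg (L p)]
        _ < ρ := by rwa [lt_div_iff₀ hD0, mul_comm] at hp
  ext Q
  simp only [Set.mem_sdiff, and_congr_left_iff]
  intro hQU
  by_cases hQP : Q ∈ range P.graph
  · obtain ⟨L, rfl⟩ := hQP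
    rw [graph_mem_gluedBase, H.graph_mem_complexLines]
    by_cases hL : ‖L p‖ < ρ / D
    · refine iff_of_false (fun h => ?_) (fun h => ?_)
      · exact hQU (hsmall L hL (h ▸ hN _))
      · exact hQU (hsmall L hL (h ▸ hC _))
    · rw [hNJ _ (not_lt.1 hL)]
  · exact mem_gluedBase_of_notMem hQP

end OrientedPlane

theorem proposition4 (n : ℕ) {E : Type*} [NormedAddCommGroup E] [InnerProductSpace ℝ E]
    [Fact (Module.finrank ℝ E = 2 * n + 1 + 1)] (P : OrientedPlane E)
    (e : OrthonormalBasis (Fin 2) ℝ P.plane) (he : e.toBasis.orientation = P.orientation)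
    (T : Submodule ℝ P.Tangent) (hT : Module.finrank ℝ T = 2 * n)
    (hTP : P.IsTransverseToBadCone T) :
    ∃ A : Module.End ℝ P.planeᗮ, HasNoRealEigenvalues A ∧ T = P.graphSubspace e A ∧
      ∃ J : Module.End ℝ P.planeᗮ, IsAssociatedComplexStructure A J ∧
        ∃ ε : ℝ, 0 < ε ∧
          (∀ U ∈ 𝓝 P, ∃ f : ℝ → ℝ, IsSlowBump ε f ∧
            P.interpolatedBase e A J f \ U =
              OrientedPlane.complexLines (P.extendComplexStructure e J) \ U) ∧
          ∀ f : ℝ → ℝ, IsSlowBump ε f →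
            IsSmoothGreatCircleFibration n (P.interpolatedBase e A J f) ∧
            OrientedPlane.IsClosedSmoothSubmanifold (2 * n) (P.interpolatedBase e A J f) ∧
            P ∈ P.interpolatedBase e A J f ∧
            OrientedPlane.tangentCone (P.interpolatedBase e A J f) P = T := by
  have hfd : FiniteDimensional ℝ E := FiniteDimensional.of_finrank_pos (by
    rw [Fact.out (p := Module.finrank ℝ E = 2 * n + 1 + 1)]; omega)
  have hP : P.IsFrame (e 0) (e 1) := ⟨e.toBasis, by simp, by simp, he⟩
  obtain ⟨A, hA, hTA⟩ := OrientedPlane.exists_eq_graphSubspace e hP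
    (hT.trans (P.finrank_orthogonal (n := n)).symm) hTP
  obtain ⟨J, hJ, hAJ⟩ := exists_isAssociatedComplexStructure hA
  obtain ⟨ε, k, hε, hk, hlow⟩ := exists_slow_lower_bound hJ hA hAJ
  obtain ⟨a, b, H⟩ := OrientedPlane.exists_isAdapted e hP hJ.apply_apply
  have hbase : ∀ f, P.interpolatedBase e A J f = P.gluedBase (e 0) (e 1)
    (radialInterpolation A J f) (P.extendComplexStructure e J) := fun f => rfl
  refine ⟨A, hA, hTA, J, hJ, ε, hε, fun U hU => ?_, fun f hf => ?_⟩
  · let Ac : P.planeᗮ →L[ℝ] P.planeᗮ := LinearMap.toContinuousLinearMap A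
    let Jc : P.planeᗮ →L[ℝ] P.planeᗮ := LinearMap.toContinuousLinearMap J
    have hAc : ∀ x, ‖A x‖ ≤ ‖Ac‖ * ‖x‖ := Ac.le_opNorm
    have hJc : ∀ x, ‖J x‖ ≤ ‖Jc‖ * ‖x‖ := Jc.le_opNorm
    obtain ⟨δ, hδ, hδU⟩ := OrientedPlane.exists_gluedBase_diff_eq H (‖Ac‖ + ‖Jc‖)
      (fun x => (hJc x).trans (by gcongr; exact le_add_of_nonneg_left (norm_nonneg Ac))) hU
    obtain ⟨f, hf, hfδ⟩ := exists_isSlowBump hε hδ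
    refine ⟨f, hf, ?_⟩
    rw [hbase]
    refine hδU _ (fun x => ?_) fun x hx => ?_
    · have h1 := hf.mem_Icc ‖x‖
      refine (norm_add_le _ _).trans ?_
      rw [norm_smul, norm_smul, Real.norm_of_nonneg h1.1, Real.norm_of_nonneg (sub_nonneg.2 h1.2),
        add_mul]
      refine add_le_add ?_ ?_
      · exact (mul_le_of_le_one_left (norm_nonneg _) h1.2).trans (hAc x)
      · exact (mul_le_of_le_one_left (norm_nonneg _) (by linarith [h1.1])).trans (hJc x)
    · rw [radialInterpolation, hfδ _ hx, zero_smul, zero_add, sub_zero, one_smul]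
  · have hN := contDiff_radialInterpolation A J hf
    obtain ⟨g, hg⟩ := exists_contDiffAt_inverse hN hk (hlow f hf)
    obtain ⟨R, hR⟩ := eventually_atTop.1 hf.eq_zero
    have hNJ : ∀ x, R ≤ ‖x‖ → radialInterpolation A J f x = J x := fun x hx => by
      rw [radialInterpolation, hR _ hx, zero_smul, zero_add, sub_zero, one_smul]
    rw [hbase]
    refine ⟨H.isSmoothGreatCircleFibration hg hN hNJ, H.isClosedSmoothSubmanifold hg hN hNJ, ?_, ?_⟩
    · have h0 : P.graph 0 ∈ P.gluedBase (e 0) (e 1)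
          (radialInterpolation A J f) (P.extendComplexStructure e J) :=
        OrientedPlane.graph_mem_gluedBase.2 (by simp [radialInterpolation])
      rwa [P.graph_zero] at h0
    · have hclosed : IsClosed (T : Set P.Tangent) := by
        have hAc : Continuous A := A.continuous_of_finiteDimensional
        rw [hTA]
        exact isClosed_eq (ContinuousLinearMap.apply ℝ P.planeᗮ (e 1)).continuous
          (hAc.comp (ContinuousLinearMap.apply ℝ P.planeᗮ (e 0)).continuous)
      -- The tangent cone depends only on the germ of the set at the origin of the chart. There `f
      -- ‖L (e 0)‖ = 1`, so the set coincides with the closed subspace `T`.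
      refine Eq.trans (tangentConeAt_congr ?_) (posTangentConeAt_submodule (V := P.Tangent) T hclosed)
      rw [nhdsWithin_eq_iff_eventuallyEq]
      have hev : ∀ᶠ L : P.Tangent in 𝓝 0, f ‖L (e 0)‖ = 1 := by
        have hc : Continuous fun L : P.Tangent => ‖L (e 0)‖ :=
          (ContinuousLinearMap.apply ℝ P.planeᗮ (e 0)).continuous.norm
        have h1 := hc.tendsto 0
        rw [zero_apply, norm_zero] at h1
        exact h1.eventually hf.eq_one
      filter_upwards [hev] with L hL
      refine propext (OrientedPlane.graph_mem_gluedBase.trans ?_)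
      rw [hTA]
      change _ ↔ L (e 1) = A (L (e 0))
      rw [radialInterpolation, hL, one_smul, sub_self, zero_smul, add_zero]
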